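/- **Definitions.** Let $B_l$ be Artin's braid group on $l$ strands; $\beta\beta'$ is $\beta'$ placed on top of $\beta$. A *mixed braid* of type $(m,n)$ is an element of $B_{m+n}$ with $m$ strands colored red (*poles*) and $n$ strands colored blue (*strands*), such that forgetting the blue strands leaves the trivial braid in $B_m$. Its bottom and top are words $o,o'$ in two letters $\mathrm p$ (pole) and $\mathrm s$ (strand). A *mixed permutation* from $o$ to $o'$ is a color-preserving permutation of the letters which becomes trivial when the blue letters are forgotten; every mixed braid $\beta$ has an underlying mixed permutation $\pi(\beta)$. The category $\mathbf{MB}$ has the words as objects, and a morphism $o\to o'$ is a pair $(\sum_j c_j\beta_j,\sigma)$ of a mixed permutation $\sigma$ from $o$ to $o'$ and a $\mathbb Q$-linear combination of mixed braids from $o$ to $o'$ with $\pi(\beta_j)=\sigma$; there are none unless $o,o'$ have the same numbers of poles and of strands. Composition is bilinear and is induced by the product of braids and of permutations. The category $\mathbf{PaMB}$ of parenthesized mixed braids has as objects the parenthesized words $O$ in $\mathrm p,\mathrm s$ (including the empty word). If $o$ is the underlying word of $O$, and $\overline O$ is the parenthesized word in $\mathrm p$ obtained by deleting the letters $\mathrm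 s$, then $\mathbf{PaMB}(O,O')=\mathbf{MB}(o,o')$ if $\overline O=\overline{O'}$, and $\mathbf{PaMB}(O,O')=\emptyset$ otherwise. A morphism given by a single mixed braid $\beta$ (that is, $(\beta,\pi(\beta))$) is called a *parenthesized mixed braid*. The *operadic operations* on $\mathbf{PaMB}$ are the following, extended linearly: adding a straight pole or a straight strand on the left or on the right, outermost in the parenthesization; doubling the $i$-th (counted at the bottom) pole or strand, where the two copies keep the color and form a pair $(\cdot\,\cdot)$ in the parenthesizations of both ends; changing a pole to a strand. The *basic morphisms* are the two crossings $\sigma_{\mathrm{ps}}^{+},\sigma_{\mathrm{ps}}^{-}\colon \mathrm{ps}\to\mathrm{sp}$ (positive and negative: the pole passes over, respectively under, the strand), and the three morphisms with trivial underlying braid $$\alpha_{\mathrm{pps}}\colon(\mathrm{pp})\mathrm s\to\mathrm p(\mathrm{ps}),\qquad \alpha_{\mathrm{psp}}\colon(\mathrm{ps})\mathrm p\to\mathrm p(\mathrm{sp}),\qquad \alpha_{\mathrm{spp}}\colon(\mathrm{sp})\mathrm p\to\mathrm s(\mathrm{pp}).$$ **Proposition 4.1.** The $\mathbb Q$-linear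 category $\mathbf{PaMB}$ is generated by the basic morphisms, their inverses, and the images of these under repeated applications of the operadic operations. That is, if $\mathcal S$ is the smallest class of morphisms which contains the basic morphisms and their inverses and is closed under the operadic operations, then 1. every parenthesized mixed braid is a composition of finitely many (possibly zero) elements of $\mathcal S$; 2. for every morphism $(x,\sigma)\colon O\to O'$ of $\mathbf{PaMB}$, the element $x$ is a $\mathbb Q$-linear combination of the first entries of morphisms $O\to O'$ that have second entry $\sigma$ and are compositions of elements of $\mathcal S$. -/

import Mathlib

open CategoryTheory

namespace MixedBraids

/-- The two kinds of strands of a mixed braid: poles (red) and strands (blue). -/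
inductive Color where
  | pole
  | strand
  deriving DecidableEq

/-- Artin's relators for generators `σ` placed at the positions `pos i`:
`σᵢ σⱼ σᵢ = σⱼ σᵢ σⱼ` for adjacent positions, `σᵢ σⱼ = σⱼ σᵢ` for positions at distance at least 2. -/
def braidRels {ι : Type} (pos : ι → ℕ) : Set (FreeGroup ι) :=
  {r | ∃ i j, pos j = pos i + 1 ∧
      r = FreeGroup.of i * FreeGroup.of j * FreeGroup.of i *
        (FreeGroup.of j * FreeGroup.of i * FreeGroup.of j)⁻¹} ∪
  {r | ∃ i j, pos i + 2 ≤ pos j ∧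
      r = FreeGroup.of i * FreeGroup.of j * (FreeGroup.of j * FreeGroup.of i)⁻¹}

/-- Artin's braid group on `l` strands, by Artin's presentation. -/
abbrev ArtinBraidGroup (l : ℕ) : Type :=
  PresentedGroup (braidRels (Fin.val : Fin (l - 1) → ℕ))

/-- The infinite braid group `B_∞ = ⋃ B_l`, with generators `σ₀, σ₁, …`. All the groups `B_l` are
treated as its subgroups `braidSubgroup l`; see `artinEquiv` for `ArtinBraidGroup l ≃* braidSubgroup l`. -/
abbrev BraidInf : Type := PresentedGroup (braidRels (id : ℕ → ℕ))

/-- The generator `σ_k`: the strand at position `k` passes over the strand at position `k + 1`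
(positions are counted from `0`, from the left). In a product `β * γ` the braid `γ` is on top of `β`. -/
def gen (k : ℕ) : BraidInf := PresentedGroup.of k

theorem lift_braidRels {ι : Type} {pos : ι → ℕ} {G : Type*} [Group G] {g : ι → G}
    (h₁ : ∀ i j, pos j = pos i + 1 → g i * g j * g i = g j * g i * g j)
    (h₂ : ∀ i j, pos i + 2 ≤ pos j → g i * g j = g j * g i) :
    ∀ r ∈ braidRels pos, FreeGroup.lift g r = 1 := by
  rintro r (⟨i, j, h, rfl⟩ | ⟨i, j, h, rfl⟩)
  · simp only [map_mul, map_inv, FreeGroup.lift_apply_of]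
    rw [h₁ i j h, mul_inv_cancel]
  · simp only [map_mul, map_inv, FreeGroup.lift_apply_of]
    rw [h₂ i j h, mul_inv_cancel]

theorem of_braid {ι : Type} {pos : ι → ℕ} {i j : ι} (h : pos j = pos i + 1) :
    (PresentedGroup.of i * PresentedGroup.of j * PresentedGroup.of i :
      PresentedGroup (braidRels pos)) =
    PresentedGroup.of j * PresentedGroup.of i * PresentedGroup.of j :=
  PresentedGroup.mk_eq_mk_of_mul_inv_mem (Or.inl ⟨i, j, h, rfl⟩)

theorem of_comm {ι : Type} {pos : ι → ℕ} {i j : ι} (h : pos i + 2 ≤ pos j) :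
    (PresentedGroup.of i * PresentedGroup.of j : PresentedGroup (braidRels pos)) =
    PresentedGroup.of j * PresentedGroup.of i :=
  PresentedGroup.mk_eq_mk_of_mul_inv_mem (Or.inr ⟨i, j, h, rfl⟩)

theorem gen_braid (k : ℕ) : gen k * gen (k + 1) * gen k = gen (k + 1) * gen k * gen (k + 1) :=
  of_braid (pos := id) rfl

theorem gen_comm {j k : ℕ} (h : j + 2 ≤ k) : gen j * gen k = gen k * gen j :=
  of_comm (pos := id) h

/-- The braid group `B_l` on the strands at the positions `0, …, l - 1`, inside `B_∞`. -/
def braidSubgroup (l : ℕ) : Subgroup BraidInf :=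
  Subgroup.closure {β | ∃ k, k + 1 < l ∧ β = gen k}

theorem braid_induction {C : BraidInf → Prop} (one : C 1) (gen' : ∀ k, C (gen k))
    (mul : ∀ β γ, C β → C γ → C (β * γ)) (inv : ∀ β, C β → C β⁻¹) (β : BraidInf) : C β := by
  have h : β ∈ Subgroup.closure (Set.range (PresentedGroup.of : ℕ → BraidInf)) := by
    rw [PresentedGroup.closure_range_of]; trivial
  induction h using Subgroup.closure_induction with
  | mem x hx => obtain ⟨k, rfl⟩ := hx; exact gen' k
  | one => exact one
  | mul x y _ _ hx hy => exact mul x y hx hy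
  | inv x _ hx => exact inv x hx

/-- `footHom β t` is the position at the bottom of the strand of `β` that ends at position `t` at
the top. -/
def footHom : BraidInf →* Equiv.Perm ℕ :=
  PresentedGroup.toGroup (f := fun k => Equiv.swap k (k + 1)) <| lift_braidRels
    (by
      rintro i j h
      obtain rfl : j = i + 1 := h
      ext x
      simp only [Equiv.Perm.mul_apply, Equiv.swap_apply_def]
      grind)
    (by
      rintro i j (h : i + 2 ≤ j)
      ext x
      simp only [Equiv.Perm.mul_apply, Equiv.swap_apply_def]
      grind)

@[simp] theorem footHom_gen (k : ℕ) : footHom (gen k) = Equiv.swap k (k + 1) :=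
  PresentedGroup.toGroup.of _

/-- The permutation underlying a braid: `strandPerm β i` is the position at the top of the strand
of `β` that starts at position `i` at the bottom. -/
def strandPerm (β : BraidInf) : Equiv.Perm ℕ := (footHom β)⁻¹

/-- Data for defining a map `eval x : B_∞ → M` letter by letter, depending on a state `x : S` that
is changed by every letter: `act k` is the change of the state under `σ_k`, and `val k x` is the value
of `σ_k` at the state `x`. The conditions say that Artin's relations are respected. -/
structure BraidCocycle (S M : Type) [Group M] where
  act : ℕ → Equiv.Perm S
  val : ℕ → S → M
  act_braid : ∀ k x, act k (act (k + 1) (act k x)) = act (k + 1) (act k (act (k + 1) x))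
  act_comm : ∀ j k, j + 2 ≤ k → ∀ x, act k (act j x) = act j (act k x)
  val_braid : ∀ k x,
    val k x * val (k + 1) (act k x) * val k (act (k + 1) (act k x)) =
      val (k + 1) x * val k (act (k + 1) x) * val (k + 1) (act k (act (k + 1) x))
  val_comm : ∀ j k, j + 2 ≤ k → ∀ x, val j x * val k (act j x) = val k x * val j (act k x)

namespace BraidCocycle

variable {S M : Type} [Group M] (D : BraidCocycle S M)

/-- The letter `σ_k` reads the current state and multiplies the value obtained so far. -/
def step (k : ℕ) : Equiv.Perm (S × M) where
  toFun p := (D.act k p.1, p.2 * D.val k p.1)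
  invFun p := ((D.act k).symm p.1, p.2 * (D.val k ((D.act k).symm p.1))⁻¹)
  left_inv p := by simp
  right_inv p := by simp

/-- The right action of `B_∞` on pairs (state, value). -/
def hom : BraidInf →* (Equiv.Perm (S × M))ᵐᵒᵖ :=
  PresentedGroup.toGroup (f := fun k => MulOpposite.op (D.step k)) <| lift_braidRels
    (by
      rintro i j h
      obtain rfl : j = i + 1 := h
      apply MulOpposite.unop_injective
      ext p : 1
      simp only [MulOpposite.unop_mul, MulOpposite.unop_op, Equiv.Perm.mul_apply]
      exact Prod.ext (D.act_braid i p.1) (by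
        simpa only [step, Equiv.coe_fn_mk, mul_assoc] using
          congrArg (p.2 * ·) (D.val_braid i p.1)))
    (by
      rintro i j (h : i + 2 ≤ j)
      apply MulOpposite.unop_injective
      ext p : 1
      simp only [MulOpposite.unop_mul, MulOpposite.unop_op, Equiv.Perm.mul_apply]
      exact Prod.ext (D.act_comm i j h p.1) (by
        simpa only [step, Equiv.coe_fn_mk, mul_assoc] using
          congrArg (p.2 * ·) (D.val_comm i j h p.1)))

/-- The state after reading the braid `β`, starting at the state `x`. -/
def move (x : S) (β : BraidInf) : S := ((D.hom β).unop (x, 1)).1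

/-- The value of `β` at the state `x`. It is determined by `eval x (σ_k) = val k x` and
`eval x (β γ) = eval x β * eval (move x β) γ`. -/
def eval (x : S) (β : BraidInf) : M := ((D.hom β).unop (x, 1)).2

theorem hom_apply (β : BraidInf) (x : S) (b : M) :
    (D.hom β).unop (x, b) = (D.move x β, b * D.eval x β) := by
  have key : ∀ (a b : M) (x : S), (D.hom β).unop (x, a * b) =
      (((D.hom β).unop (x, b)).1, a * ((D.hom β).unop (x, b)).2) := by
    induction β using braid_induction with
    | one => simp
    | gen' k => intro a b x; simp [hom, gen, step, mul_assoc]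
    | mul β γ hβ hγ =>
      intro a b x
      simp only [map_mul, MulOpposite.unop_mul, Equiv.Perm.mul_apply]
      rw [hβ, hγ]
    | inv β hβ =>
      intro a b x
      simp only [map_inv, MulOpposite.unop_inv]
      rw [Equiv.Perm.inv_eq_iff_eq, hβ]
      simp
  simpa [move, eval] using key b 1 x

@[simp] theorem move_gen (x : S) (k : ℕ) : D.move x (gen k) = D.act k x := by
  simp [move, hom, gen, step]

@[simp] theorem eval_gen (x : S) (k : ℕ) : D.eval x (gen k) = D.val k x := by
  simp [eval, hom, gen, step]

@[simp] theorem move_one (x : S) : D.move x 1 = x := by simp [move]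

@[simp] theorem eval_one (x : S) : D.eval x 1 = 1 := by simp [eval]

theorem move_mul (x : S) (β γ : BraidInf) : D.move x (β * γ) = D.move (D.move x β) γ := by
  have := D.hom_apply (β * γ) x 1
  simp only [map_mul, MulOpposite.unop_mul, Equiv.Perm.mul_apply, hom_apply] at this
  exact (congrArg Prod.fst this).symm

theorem eval_mul (x : S) (β γ : BraidInf) :
    D.eval x (β * γ) = D.eval x β * D.eval (D.move x β) γ := by
  have := D.hom_apply (β * γ) x 1
  simp only [map_mul, MulOpposite.unop_mul, Equiv.Perm.mul_apply, hom_apply] at this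
  simpa using (congrArg Prod.snd this).symm

end BraidCocycle


section Blocks

variable {G : Type} [Group G] {a b c : G}

theorem block₁ (h₁ : a * b * a = b * a * b) (h₂ : b * c * b = c * b * c) (h₃ : a * c = c * a) :
    b * a * (c * b) * a = c * (b * a) * (c * b) :=
  calc b * a * (c * b) * a = b * (a * c) * b * a := by group
    _ = b * c * (a * b * a) := by rw [h₃]; group
    _ = (b * c * b) * a * b := by rw [h₁]; group
    _ = c * b * (c * a) * b := by rw [h₂]; group
    _ = c * (b * a) * (c * b) := by rw [← h₃]; group

theorem block₂ (h₁ : a * b * a = b * a * b) (h₂ : b * c * b = c * b * c) (h₃ : a * c = c * a) :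
    a * b * c * (b * a) = c * b * a * (b * c) :=
  calc a * b * c * (b * a) = a * (b * c * b) * a := by group
    _ = (a * c) * b * (c * a) := by rw [h₂]; group
    _ = c * a * b * (c * a) := by rw [h₃]
    _ = c * a * b * (a * c) := by rw [h₃]
    _ = c * (a * b * a) * c := by group
    _ = c * b * a * (b * c) := by rw [h₁]; group

theorem block₃ (h₁ : a * b * a = b * a * b) (h₂ : b * c * b = c * b * c) (h₃ : a * c = c * a) :
    a * (b * c) * (a * b) = b * c * (a * b) * c :=
  calc a * (b * c) * (a * b) = a * b * (c * a) * b := by group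
    _ = (a * b * a) * c * b := by rw [← h₃]; group
    _ = b * a * (b * c * b) := by rw [h₁]; group
    _ = b * (a * c) * b * c := by rw [h₂]; group
    _ = b * c * (a * b) * c := by rw [h₃]; group

end Blocks

/-- The crossing `σ_k` after doubling the strand that is at position `i` at the bottom. -/
def cableVal (k i : ℕ) : BraidInf :=
  if i < k then gen (k + 1)
  else if i = k then gen (k + 1) * gen k
  else if i = k + 1 then gen k * gen (k + 1)
  else gen k

theorem cableVal_lt {k i : ℕ} (h : i < k) : cableVal k i = gen (k + 1) := if_pos h
theorem cableVal_self (k : ℕ) : cableVal k k = gen (k + 1) * gen k := by simp [cableVal]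
theorem cableVal_succ (k : ℕ) : cableVal k (k + 1) = gen k * gen (k + 1) := by simp [cableVal]
theorem cableVal_gt {k i : ℕ} (h : k + 1 < i) : cableVal k i = gen k := by
  unfold cableVal; grind

theorem swap_lt {k i : ℕ} (h : i < k) : Equiv.swap k (k + 1) i = i :=
  Equiv.swap_apply_of_ne_of_ne (by omega) (by omega)
theorem swap_gt {k i : ℕ} (h : k + 1 < i) : Equiv.swap k (k + 1) i = i :=
  Equiv.swap_apply_of_ne_of_ne (by omega) (by omega)

/-- Doubling a strand; the state is the position of the strand that is doubled. -/
def cableCocycle : BraidCocycle ℕ BraidInf where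
  act k := Equiv.swap k (k + 1)
  val := cableVal
  act_braid k x := by
    simp only [Equiv.swap_apply_def]; grind
  act_comm j k h x := by
    simp only [Equiv.swap_apply_def]; grind
  val_braid k x := by
    have h1 := gen_braid k
    have h2 : gen (k + 1) * gen (k + 2) * gen (k + 1) =
      gen (k + 2) * gen (k + 1) * gen (k + 2) := gen_braid (k + 1)
    have h3 : gen k * gen (k + 2) = gen (k + 2) * gen k := gen_comm le_rfl
    have hx : x < k ∨ x = k ∨ x = k + 1 ∨ x = k + 2 ∨ k + 2 < x := by omega
    have s1 : Equiv.swap (k + 1) (k + 1 + 1) k = k := swap_lt (by omega)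
    have s2 : Equiv.swap k (k + 1) (k + 2) = k + 2 := swap_gt (by omega)
    have s3 : Equiv.swap (k + 1) (k + 1 + 1) (k + 1) = k + 2 := Equiv.swap_apply_left _ _
    have s4 : Equiv.swap (k + 1) (k + 1 + 1) (k + 2) = k + 1 := Equiv.swap_apply_right _ _
    have v1 : cableVal (k + 1) (k + 2) = gen (k + 1) * gen (k + 2) := cableVal_succ (k + 1)
    have v2 : cableVal (k + 1) (k + 1) = gen (k + 2) * gen (k + 1) := cableVal_self (k + 1)
    rcases hx with h | rfl | rfl | rfl | h
    · simp only [swap_lt h, swap_lt (Nat.lt_succ_of_lt h), cableVal_lt h,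
        cableVal_lt (Nat.lt_succ_of_lt h)]
      exact h2
    · simp only [s1, s3, Equiv.swap_apply_left, cableVal_self,
        cableVal_lt (Nat.lt_succ_self _), cableVal_gt (Nat.lt_succ_self _)]
      exact block₁ h1 h2 h3
    · simp only [s1, s2, s3, Equiv.swap_apply_right, cableVal_self, cableVal_succ,
        cableVal_lt (Nat.lt_succ_self _), cableVal_gt (Nat.lt_succ_self _)]
      exact block₂ h1 h2 h3
    · simp only [s2, s4, Equiv.swap_apply_right, cableVal_succ,
        cableVal_lt (Nat.lt_succ_self _), cableVal_gt (Nat.lt_succ_self _)]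
      exact block₃ h1 h2 h3
    · have h' : k + 1 < x := by omega
      have h'' : k + 1 + 1 < x := by omega
      simp only [swap_gt h', swap_gt h'', cableVal_gt h', cableVal_gt h'']
      exact h1
  val_comm j k h x := by
    have h1 := gen_comm h
    have h2 : gen (j + 1) * gen (k + 1) = gen (k + 1) * gen (j + 1) := gen_comm (by omega)
    have h3 : gen j * gen (k + 1) = gen (k + 1) * gen j := gen_comm (by omega)
    have hx : x < j ∨ x = j ∨ x = j + 1 ∨ (j + 1 < x ∧ x < k) ∨ x = k ∨ x = k + 1 ∨ k + 1 < x := by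
      omega
    rcases hx with h | rfl | rfl | ⟨h, h'⟩ | rfl | rfl | h'
    · have h' : x < k := by omega
      simp only [swap_lt h, swap_lt h', cableVal_lt h, cableVal_lt h']
      exact h2
    · have h' : x < k := by omega
      have h'' : x + 1 < k := by omega
      simp only [swap_lt h', Equiv.swap_apply_left, cableVal_self, cableVal_lt h', cableVal_lt h'']
      rw [mul_assoc, h3, ← mul_assoc, h2, mul_assoc]
    · have h' : j < k := by omega
      have h'' : j + 1 < k := by omega
      simp only [swap_lt h'', Equiv.swap_apply_right, cableVal_succ, cableVal_lt h',
        cableVal_lt h'']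
      rw [mul_assoc, h2, ← mul_assoc, h3, mul_assoc]
    · simp only [swap_gt h, swap_lt h', cableVal_gt h, cableVal_lt h']
      exact h3
    · have h' : j + 1 < x := by omega
      have h'' : j + 1 < x + 1 := by omega
      simp only [swap_gt h', Equiv.swap_apply_left, cableVal_self, cableVal_gt h', cableVal_gt h'']
      rw [← mul_assoc, h3, mul_assoc, h1, mul_assoc]
    · have h' : j + 1 < k := by omega
      have h'' : j + 1 < k + 1 := by omega
      simp only [swap_gt h'', Equiv.swap_apply_right, cableVal_succ, cableVal_gt h',
        cableVal_gt h'']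
      rw [← mul_assoc, h1, mul_assoc, h3, mul_assoc]
    · have h : j + 1 < x := by omega
      simp only [swap_gt h, swap_gt h', cableVal_gt h, cableVal_gt h']
      exact h1


/-- The number of poles at positions `< n` in the coloring `c`. -/
def polesBelow (c : ℕ → Color) (n : ℕ) : ℕ := Nat.count (fun i => c i = Color.pole) n

/-- The effect of the crossing `σ_k` on the colors of the end points. -/
def permuteColors (k : ℕ) : Equiv.Perm (ℕ → Color) where
  toFun c := c ∘ Equiv.swap k (k + 1)
  invFun c := c ∘ Equiv.swap k (k + 1)
  left_inv c := by ext x; simp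
  right_inv c := by ext x; simp

/-- The crossing `σ_k` after forgetting all blue strands: it survives if and only if both of its
strands are poles, and its new position is the number of poles to the left of it. -/
def forgetVal {M : Type} [Group M] (g : ℕ → M) (k : ℕ) (c : ℕ → Color) : M :=
  if c k = Color.pole ∧ c (k + 1) = Color.pole then g (polesBelow c k) else 1

theorem polesBelow_succ (c : ℕ → Color) (n : ℕ) :
    polesBelow c (n + 1) = polesBelow c n + if c n = Color.pole then 1 else 0 :=
  Nat.count_succ _ _

theorem polesBelow_congr {c c' : ℕ → Color} {n : ℕ} (h : ∀ i < n, c i = c' i) :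
    polesBelow c n = polesBelow c' n := by
  induction n with
  | zero => rfl
  | succ n ih =>
    rw [polesBelow_succ, polesBelow_succ, ih fun i hi => h i (by omega), h n (by omega)]

theorem permuteColors_apply (k : ℕ) (c : ℕ → Color) (x : ℕ) :
    permuteColors k c x = c (if x = k then k + 1 else if x = k + 1 then k else x) := by
  simp [permuteColors, Equiv.swap_apply_def]

theorem permuteColors_self (k : ℕ) (c : ℕ → Color) : permuteColors k c k = c (k + 1) := by
  simp [permuteColors_apply]

theorem permuteColors_succ (k : ℕ) (c : ℕ → Color) : permuteColors k c (k + 1) = c k := by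
  simp [permuteColors_apply]

theorem permuteColors_ne {k x : ℕ} (h : x ≠ k) (h' : x ≠ k + 1) (c : ℕ → Color) :
    permuteColors k c x = c x := by
  simp [permuteColors_apply, h, h']

theorem polesBelow_permute_le {k n : ℕ} (h : n ≤ k) (c : ℕ → Color) :
    polesBelow (permuteColors k c) n = polesBelow c n :=
  polesBelow_congr fun i hi => permuteColors_ne (by omega) (by omega) c

theorem polesBelow_permute_ge {k n : ℕ} (h : k + 2 ≤ n) (c : ℕ → Color) :
    polesBelow (permuteColors k c) n = polesBelow c n := by
  induction n, h using Nat.le_induction with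
  | base =>
    rw [polesBelow_succ, polesBelow_succ, polesBelow_succ, polesBelow_succ, permuteColors_self,
      permuteColors_succ, polesBelow_permute_le le_rfl]
    omega
  | succ n h ih =>
    rw [polesBelow_succ, polesBelow_succ, ih, permuteColors_ne (by omega) (by omega)]

theorem permuteColors_braid (k : ℕ) (c : ℕ → Color) :
    permuteColors k (permuteColors (k + 1) (permuteColors k c)) =
      permuteColors (k + 1) (permuteColors k (permuteColors (k + 1) c)) := by
  ext x
  simp only [permuteColors_apply]
  grind

theorem permuteColors_comm {j k : ℕ} (h : j + 2 ≤ k) (c : ℕ → Color) :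
    permuteColors k (permuteColors j c) = permuteColors j (permuteColors k c) := by
  ext x
  simp only [permuteColors_apply]
  grind

theorem forgetVal_braid {M : Type} [Group M] (g : ℕ → M) (k : ℕ) (c : ℕ → Color)
    (hg : c k = Color.pole → c (k + 1) = Color.pole → c (k + 2) = Color.pole →
      g (polesBelow c k) * g (polesBelow c k + 1) * g (polesBelow c k) =
        g (polesBelow c k + 1) * g (polesBelow c k) * g (polesBelow c k + 1)) :
    forgetVal g k c * forgetVal g (k + 1) (permuteColors k c) *
        forgetVal g k (permuteColors (k + 1) (permuteColors k c)) =
      forgetVal g (k + 1) c * forgetVal g k (permuteColors (k + 1) c) *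
        forgetVal g (k + 1) (permuteColors k (permuteColors (k + 1) c)) := by
  have e : k + 1 + 1 = k + 2 := rfl
  have s1 : ∀ c, permuteColors (k + 1) c k = c k := fun c =>
    permuteColors_ne (by omega) (by omega) c
  have s2 : ∀ c, permuteColors k c (k + 2) = c (k + 2) := fun c =>
    permuteColors_ne (by omega) (by omega) c
  have s3 : ∀ c, permuteColors (k + 1) c (k + 2) = c (k + 1) := permuteColors_succ (k + 1)
  have p1 : ∀ c, polesBelow (permuteColors (k + 1) c) k = polesBelow c k := fun c =>
    polesBelow_permute_le (by omega) c
  simp only [forgetVal, e, s1, s2, s3, permuteColors_self, permuteColors_succ, polesBelow_succ,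
    polesBelow_permute_le le_rfl, p1]
  rcases h0 : c k with _ | _ <;> rcases h1 : c (k + 1) with _ | _ <;>
    rcases h2 : c (k + 2) with _ | _ <;> simp
  simpa using hg h0 h1 h2

theorem forgetVal_comm {M : Type} [Group M] (g : ℕ → M) {j k : ℕ} (h : j + 2 ≤ k) (c : ℕ → Color)
    (hg : c j = Color.pole → c (j + 1) = Color.pole → c k = Color.pole →
      c (k + 1) = Color.pole →
      g (polesBelow c j) * g (polesBelow c k) = g (polesBelow c k) * g (polesBelow c j)) :
    forgetVal g j c * forgetVal g k (permuteColors j c) =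
      forgetVal g k c * forgetVal g j (permuteColors k c) := by
  simp only [forgetVal, polesBelow_permute_le (show j ≤ k by omega), polesBelow_permute_ge h,
    permuteColors_ne (show j ≠ k by omega) (show j ≠ k + 1 by omega),
    permuteColors_ne (show j + 1 ≠ k by omega) (show j + 1 ≠ k + 1 by omega),
    permuteColors_ne (show k ≠ j by omega) (show k ≠ j + 1 by omega),
    permuteColors_ne (show k + 1 ≠ j by omega) (show k + 1 ≠ j + 1 by omega)]
  by_cases h1 : c j = Color.pole ∧ c (j + 1) = Color.pole <;>
    by_cases h2 : c k = Color.pole ∧ c (k + 1) = Color.pole <;> simp [h1, h2]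
  exact hg h1.1 h1.2 h2.1 h2.2

theorem polesBelow_add_two_le {c : ℕ → Color} {j k : ℕ} (h : j + 2 ≤ k) (h₀ : c j = Color.pole)
    (h₁ : c (j + 1) = Color.pole) : polesBelow c j + 2 ≤ polesBelow c k := by
  have : polesBelow c (j + 2) = polesBelow c j + 2 := by
    rw [polesBelow_succ, polesBelow_succ]; simp [h₀, h₁]
  rw [← this]
  exact Nat.count_monotone _ h

/-- Forgetting all blue strands; the state is the coloring of the end points. -/
def forgetCocycle : BraidCocycle (ℕ → Color) BraidInf where
  act := permuteColors
  val := forgetVal gen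
  act_braid := permuteColors_braid
  act_comm _ _ h c := permuteColors_comm h c
  val_braid k c := forgetVal_braid gen k c fun _ _ _ => gen_braid _
  val_comm _ _ h c := forgetVal_comm gen h c fun h₀ h₁ _ _ =>
    gen_comm (polesBelow_add_two_le h h₀ h₁)

/-- The braid obtained from `β`, colored by `c` at the bottom, by forgetting all blue strands. -/
def forget (c : ℕ → Color) (β : BraidInf) : BraidInf := forgetCocycle.eval c β

/-- The braid obtained from `β` by doubling the strand at position `i` at the bottom. -/
def cable (i : ℕ) (β : BraidInf) : BraidInf := cableCocycle.eval i β

theorem forget_move (c : ℕ → Color) (β : BraidInf) :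
    forgetCocycle.move c β = c ∘ footHom β := by
  induction β using braid_induction generalizing c with
  | one => ext; simp
  | gen' k => simp [forgetCocycle, permuteColors]
  | mul β γ hβ hγ => rw [BraidCocycle.move_mul, hβ, hγ]; ext; simp
  | inv β hβ =>
    have h := forgetCocycle.move_mul (c ∘ ⇑(footHom β⁻¹)) β β⁻¹
    rw [mul_inv_cancel, BraidCocycle.move_one, hβ] at h
    rw [h]; congr 1; ext; simp

theorem strandPerm_mul (β γ : BraidInf) :
    strandPerm (β * γ) = (strandPerm β).trans (strandPerm γ) := by
  ext; simp [strandPerm]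

theorem cable_move (i : ℕ) (β : BraidInf) : cableCocycle.move i β = strandPerm β i := by
  induction β using braid_induction generalizing i with
  | one => simp [strandPerm]
  | gen' k => simp [cableCocycle, strandPerm]
  | mul β γ hβ hγ => rw [BraidCocycle.move_mul, hβ, hγ]; simp [strandPerm]
  | inv β hβ =>
    have h := cableCocycle.move_mul (strandPerm β⁻¹ i) β β⁻¹
    rw [mul_inv_cancel, BraidCocycle.move_one, hβ] at h
    rw [h]; congr 1; simp [strandPerm]

theorem forget_mul (c : ℕ → Color) (β γ : BraidInf) :
    forget c (β * γ) = forget c β * forget (c ∘ footHom β) γ := by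
  rw [forget, BraidCocycle.eval_mul, forget_move]; rfl

theorem cable_mul (i : ℕ) (β γ : BraidInf) :
    cable i (β * γ) = cable i β * cable (strandPerm β i) γ := by
  rw [cable, BraidCocycle.eval_mul, cable_move]; rfl

theorem cocycle_ext {S M : Type} [Group M] {act : S → BraidInf → S}
    (act_mul : ∀ x β γ, act x (β * γ) = act (act x β) γ) (act_one : ∀ x, act x 1 = x)
    {F G : S → BraidInf → M}
    (hF : ∀ x β γ, F x (β * γ) = F x β * F (act x β) γ)
    (hG : ∀ x β γ, G x (β * γ) = G x β * G (act x β) γ)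
    (h : ∀ x k, F x (gen k) = G x (gen k)) (x : S) (β : BraidInf) : F x β = G x β := by
  have F1 : ∀ x, F x 1 = 1 := fun x => by simpa [act_one] using hF x 1 1
  have G1 : ∀ x, G x 1 = 1 := fun x => by simpa [act_one] using hG x 1 1
  induction β using braid_induction generalizing x with
  | one => rw [F1, G1]
  | gen' k => exact h x k
  | mul β γ hβ hγ => rw [hF, hG, hβ, hγ]
  | inv β hβ =>
    have h1 := hF (act x β⁻¹) β β⁻¹
    have h2 := hG (act x β⁻¹) β β⁻¹
    rw [mul_inv_cancel, F1, ← act_mul, inv_mul_cancel, act_one] at h1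
    rw [mul_inv_cancel, G1, ← act_mul, inv_mul_cancel, act_one] at h2
    rw [← mul_right_inj (F (act x β⁻¹) β), ← h1, hβ, ← h2]


/-- The generator `σ_k` of Artin's braid group, or `1` if there is none. -/
def genOrOne (l k : ℕ) : ArtinBraidGroup l :=
  if h : k < l - 1 then PresentedGroup.of ⟨k, h⟩ else 1

theorem genOrOne_braid {l k : ℕ} (h : k + 2 < l) :
    genOrOne l k * genOrOne l (k + 1) * genOrOne l k =
      genOrOne l (k + 1) * genOrOne l k * genOrOne l (k + 1) := by
  rw [genOrOne, genOrOne, dif_pos (by omega), dif_pos (by omega)]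
  exact of_braid (pos := (Fin.val : Fin (l - 1) → ℕ)) rfl

theorem genOrOne_comm {l j k : ℕ} (h : j + 2 ≤ k) (hk : k + 1 < l) :
    genOrOne l j * genOrOne l k = genOrOne l k * genOrOne l j := by
  rw [genOrOne, genOrOne, dif_pos (by omega), dif_pos (by omega)]
  exact of_comm (pos := (Fin.val : Fin (l - 1) → ℕ)) h

/-- There are at most `l` poles. -/
def AtMostPoles (l : ℕ) (c : ℕ → Color) : Prop := ∀ n, polesBelow c n ≤ l

theorem atMostPoles_permute (l k : ℕ) (c : ℕ → Color) :
    AtMostPoles l (permuteColors k c) ↔ AtMostPoles l c := by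
  have key : ∀ c, AtMostPoles l c → AtMostPoles l (permuteColors k c) := by
    intro c h n
    have h1 : polesBelow (permuteColors k c) n ≤ polesBelow (permuteColors k c) (n + k + 2) :=
      Nat.count_monotone _ (by omega)
    rw [polesBelow_permute_ge (n := n + k + 2) (by omega)] at h1
    exact h1.trans (h _)
  refine ⟨fun h => ?_, key c⟩
  have := key _ h
  rwa [show permuteColors k (permuteColors k c) = c from (permuteColors k).left_inv c] at this

open Classical in
noncomputable def retractCocycle (l : ℕ) : BraidCocycle (ℕ → Color) (ArtinBraidGroup l) where
  act := permuteColors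
  val k c := if AtMostPoles l c then forgetVal (genOrOne l) k c else 1
  act_braid := permuteColors_braid
  act_comm _ _ h c := permuteColors_comm h c
  val_braid k c := by
    simp only [atMostPoles_permute]
    split_ifs with hc
    · refine forgetVal_braid _ k c fun h₀ h₁ h₂ => genOrOne_braid ?_
      have := hc (k + 3)
      rw [polesBelow_succ, polesBelow_succ, polesBelow_succ] at this
      simp only [h₀, h₁, h₂, if_true] at this
      omega
    · rfl
  val_comm j k h c := by
    simp only [atMostPoles_permute]
    split_ifs with hc
    · refine forgetVal_comm _ h c fun h₀ h₁ h₂ h₃ =>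
        genOrOne_comm (polesBelow_add_two_le h h₀ h₁) ?_
      have := hc (k + 2)
      rw [polesBelow_succ, polesBelow_succ] at this
      simp only [h₂, h₃, if_true] at this
      omega
    · rfl

/-- The homomorphism from Artin's braid group on `l` strands to `B_∞`. -/
def toInf (l : ℕ) : ArtinBraidGroup l →* BraidInf :=
  PresentedGroup.toGroup (f := fun k : Fin (l - 1) => gen k) <| lift_braidRels
    (fun i j h => by rw [h]; exact gen_braid i)
    (fun i j h => gen_comm h)

@[simp] theorem toInf_of (l : ℕ) (k : Fin (l - 1)) : toInf l (PresentedGroup.of k) = gen k :=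
  PresentedGroup.toGroup.of _

theorem toInf_injective (l : ℕ) : Function.Injective (toInf l) := by
  let c₀ : ℕ → Color := fun i => if i < l then Color.pole else Color.strand
  have hp : ∀ n, polesBelow c₀ n = min n l := by
    intro n
    induction n with
    | zero => simp [polesBelow]
    | succ n ih =>
      rw [polesBelow_succ, ih]
      by_cases h : n < l <;> simp [c₀, h] <;> omega
  have key : ∀ x : ArtinBraidGroup l, (retractCocycle l).move c₀ (toInf l x) = c₀ ∧
      (retractCocycle l).eval c₀ (toInf l x) = x := by
    intro x
    have hx : x ∈ Subgroup.closure (Set.range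
        (PresentedGroup.of : Fin (l - 1) → ArtinBraidGroup l)) := by
      rw [PresentedGroup.closure_range_of]; trivial
    induction hx using Subgroup.closure_induction with
    | mem x hx =>
      obtain ⟨k, rfl⟩ := hx
      have hk := k.2
      have hc : AtMostPoles l c₀ := fun n => by rw [hp]; omega
      refine ⟨?_, ?_⟩
      · rw [toInf_of, BraidCocycle.move_gen]
        ext x
        simp only [retractCocycle, permuteColors_apply, c₀]
        grind
      · rw [toInf_of, BraidCocycle.eval_gen]
        have h1 : c₀ (k : ℕ) = Color.pole := by simp only [c₀]; grind
        have h2 : c₀ ((k : ℕ) + 1) = Color.pole := by simp only [c₀]; grind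
        simp only [retractCocycle, if_pos hc, forgetVal, h1, h2, and_self, if_true, hp]
        rw [min_eq_left (by omega), genOrOne, dif_pos hk]
    | one => simp
    | mul x y _ _ hx hy =>
      rw [map_mul, BraidCocycle.move_mul, BraidCocycle.eval_mul, hx.1, hx.2, hy.1, hy.2]
      exact ⟨rfl, rfl⟩
    | inv x _ hx =>
      have h1 := (retractCocycle l).move_mul c₀ (toInf l x) (toInf l x⁻¹)
      have h2 := (retractCocycle l).eval_mul c₀ (toInf l x) (toInf l x⁻¹)
      rw [hx.1, ← map_mul, mul_inv_cancel, map_one, BraidCocycle.move_one] at h1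
      rw [hx.1, hx.2, ← map_mul, mul_inv_cancel, map_one, BraidCocycle.eval_one] at h2
      exact ⟨h1.symm, (inv_eq_of_mul_eq_one_right h2.symm).symm⟩
  intro x y h
  rw [← (key x).2, ← (key y).2, h]

theorem toInf_range (l : ℕ) : (toInf l).range = braidSubgroup l := by
  rw [MonoidHom.range_eq_map, ← PresentedGroup.closure_range_of, MonoidHom.map_closure,
    braidSubgroup]
  congr 1
  ext β
  constructor
  · rintro ⟨_, ⟨k, rfl⟩, rfl⟩
    exact ⟨k, by have := k.2; omega, toInf_of l k⟩
  · rintro ⟨k, hk, rfl⟩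
    exact ⟨_, ⟨⟨k, by omega⟩, rfl⟩, toInf_of l _⟩

/-- The subgroup `braidSubgroup l` of `B_∞` is Artin's braid group on `l` strands. -/
noncomputable def artinEquiv (l : ℕ) : ArtinBraidGroup l ≃* braidSubgroup l :=
  (MonoidHom.ofInjective (toInf_injective l)).trans (MulEquiv.subgroupCongr (toInf_range l))

theorem artinEquiv_of (l : ℕ) (k : Fin (l - 1)) :
    (artinEquiv l (PresentedGroup.of k) : BraidInf) = gen k :=
  toInf_of l k

/-- Adding a straight strand on the left. -/
def shift : BraidInf →* BraidInf :=
  PresentedGroup.toGroup (f := fun k => gen (k + 1)) <| lift_braidRels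
    (by rintro i j h; obtain rfl : j = i + 1 := h; exact gen_braid (i + 1))
    (by rintro i j (h : i + 2 ≤ j); exact gen_comm (by omega))

@[simp] theorem shift_gen (k : ℕ) : shift (gen k) = gen (k + 1) := PresentedGroup.toGroup.of _

/-- After doubling the position `i`: the new positions are the old ones, where `i` stands for the
first copy, and `none`, which is the second copy and sits at the position `i + 1`. -/
def doubling (i : ℕ) : ℕ ≃ Option ℕ where
  toFun x := if x ≤ i then some x else if x = i + 1 then none else some (x - 1)
  invFun y := y.elim (i + 1) fun x => if x ≤ i then x else x + 1
  left_inv x := by dsimp only; split_ifs <;> simp <;> grind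
  right_inv y := by
    cases y with
    | none => simp
    | some x => simp only [Option.elim]; grind

/-- The permutation `σ` after doubling the strand at position `i` at the bottom. -/
def cablePerm (i : ℕ) (σ : Equiv.Perm ℕ) : Equiv.Perm ℕ :=
  (doubling i).trans ((Equiv.optionCongr σ).trans (doubling (σ i)).symm)

/-- The permutation `σ` after adding a straight strand on the left. -/
def shiftPerm (σ : Equiv.Perm ℕ) : Equiv.Perm ℕ where
  toFun x := Nat.casesOn x 0 fun y => σ y + 1
  invFun x := Nat.casesOn x 0 fun y => σ.symm y + 1
  left_inv x := by cases x <;> simp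
  right_inv x := by cases x <;> simp

@[simp] theorem shiftPerm_zero (σ : Equiv.Perm ℕ) : shiftPerm σ 0 = 0 := rfl
@[simp] theorem shiftPerm_succ (σ : Equiv.Perm ℕ) (x : ℕ) : shiftPerm σ (x + 1) = σ x + 1 := rfl

theorem cablePerm_apply (i : ℕ) (σ : Equiv.Perm ℕ) (x : ℕ) :
    cablePerm i σ x =
      if x = i + 1 then σ i + 1
      else if σ (if x ≤ i then x else x - 1) ≤ σ i then σ (if x ≤ i then x else x - 1)
      else σ (if x ≤ i then x else x - 1) + 1 := by
  by_cases h1 : x ≤ i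
  · have h2 : x ≠ i + 1 := by omega
    simp [cablePerm, doubling, h1, h2]
  · by_cases h2 : x = i + 1 <;> simp [cablePerm, doubling, h1, h2]

theorem cablePerm_trans (i : ℕ) (σ τ : Equiv.Perm ℕ) :
    cablePerm i (σ.trans τ) = (cablePerm i σ).trans (cablePerm (σ i) τ) := by
  ext x
  simp only [cablePerm, Equiv.trans_apply, Equiv.apply_symm_apply, Equiv.optionCongr_apply]
  rcases doubling i x with _ | y <;> simp

theorem footHom_gen_apply (k x : ℕ) :
    footHom (gen k) x = if x = k then k + 1 else if x = k + 1 then k else x := by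
  simp [Equiv.swap_apply_def]

theorem cable_gen (i k : ℕ) : cable i (gen k) = cableVal k i :=
  cableCocycle.eval_gen i k

theorem forget_gen (c : ℕ → Color) (k : ℕ) : forget c (gen k) = forgetVal gen k c :=
  forgetCocycle.eval_gen c k

theorem forget_one (c : ℕ → Color) : forget c 1 = 1 := forgetCocycle.eval_one c

theorem cable_one (i : ℕ) : cable i 1 = 1 := cableCocycle.eval_one i

theorem footHom_eq (β : BraidInf) : footHom β = (strandPerm β)⁻¹ := by simp [strandPerm]

theorem strandPerm_gen (k : ℕ) : strandPerm (gen k) = Equiv.swap k (k + 1) := by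
  simp [strandPerm]

theorem footHom_cable (i : ℕ) (β : BraidInf) :
    footHom (cable i β) = (cablePerm i (strandPerm β))⁻¹ := by
  refine cocycle_ext (act := fun i β => strandPerm β i)
    (F := fun i β => footHom (cable i β)) (G := fun i β => (cablePerm i (strandPerm β))⁻¹)
    ?_ ?_ ?_ ?_ ?_ i β
  · intro x β γ; simp [strandPerm_mul]
  · intro x; simp [strandPerm]
  · intro x β γ; simp [cable_mul]
  · intro x β γ
    simp only [strandPerm_mul, cablePerm_trans]
    ext; simp [Equiv.Perm.inv_def]
  · intro i k
    rw [cable_gen, eq_inv_iff_mul_eq_one, strandPerm_gen]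
    ext x
    simp only [Equiv.Perm.mul_apply, cablePerm_apply, cableVal, Equiv.swap_apply_def,
      Equiv.Perm.one_apply]
    split_ifs <;> simp only [map_mul, Equiv.Perm.mul_apply, footHom_gen_apply] <;> grind

theorem strandPerm_cable (i : ℕ) (β : BraidInf) :
    strandPerm (cable i β) = cablePerm i (strandPerm β) := by
  rw [strandPerm, footHom_cable, inv_inv]

theorem strandPerm_shift (β : BraidInf) : strandPerm (shift β) = shiftPerm (strandPerm β) := by
  induction β using braid_induction with
  | one => ext x; cases x <;> simp [strandPerm]
  | gen' k =>
    ext x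
    rcases x with _ | x
    · simp [strandPerm, Equiv.swap_apply_def]
    · simp only [shift_gen, strandPerm_gen, shiftPerm_succ, Equiv.swap_apply_def]; grind
  | mul β γ hβ hγ =>
    rw [map_mul, strandPerm_mul, strandPerm_mul, hβ, hγ]
    ext x; cases x <;> simp
  | inv β hβ =>
    have e : ∀ γ, strandPerm γ⁻¹ = (strandPerm γ).symm := fun γ => by
      ext; simp [strandPerm, Equiv.Perm.inv_def]
    rw [map_inv, e, e, hβ]
    ext x; cases x <;> rfl

/-- The coloring after doubling position `i`. -/
def cableColors (c : ℕ → Color) (i x : ℕ) : Color := c (if x ≤ i then x else x - 1)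

/-- The coloring after adding the color `d` on the left. -/
def shiftColors (d : Color) (c : ℕ → Color) (x : ℕ) : Color := Nat.casesOn x d c

theorem forget_perm (c : ℕ → Color) (i : ℕ) (hi : c i = Color.pole) (β : BraidInf) :
    strandPerm (forget c β) (polesBelow c i) =
      polesBelow (c ∘ footHom β) (strandPerm β i) := by
  induction β using braid_induction generalizing c i with
  | one => simp [forget_one, strandPerm]
  | gen' k =>
    have hc : c ∘ ⇑(footHom (gen k)) = permuteColors k c := by simp [permuteColors]
    rw [hc, strandPerm_gen, forget_gen, forgetVal]
    rcases lt_trichotomy i k with h | rfl | h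
    · rw [swap_lt h, polesBelow_permute_le h.le]
      split_ifs with hk
      · have : polesBelow c i < polesBelow c k := Nat.count_strict_mono hi h
        rw [strandPerm_gen, swap_lt this]
      · simp [strandPerm]
    · rw [Equiv.swap_apply_left, polesBelow_succ, polesBelow_permute_le le_rfl, permuteColors_self]
      simp only [hi, true_and]
      split_ifs with hk
      · simp [strandPerm_gen]
      · simp [strandPerm]
    · rcases (show i = k + 1 ∨ k + 1 < i by omega) with rfl | h
      · rw [Equiv.swap_apply_right, polesBelow_succ, polesBelow_permute_le le_rfl]
        simp only [hi, and_true]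
        split_ifs with hk
        · simp [strandPerm_gen]
        · simp [strandPerm]
      · rw [swap_gt h, polesBelow_permute_ge h]
        split_ifs with hk
        · have := polesBelow_add_two_le (k := i) h hk.1 hk.2
          rw [strandPerm_gen, swap_gt (by omega)]
        · simp [strandPerm]
  | mul β γ hβ hγ =>
    rw [forget_mul, strandPerm_mul, strandPerm_mul, Equiv.trans_apply, Equiv.trans_apply,
      hβ c i hi, hγ _ _ (by simpa [strandPerm] using hi)]
    congr 1; ext; simp
  | inv β hβ =>
    have h := hβ (c ∘ ⇑(footHom β⁻¹)) (strandPerm β⁻¹ i) (by simpa [strandPerm] using hi)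
    have e : (c ∘ ⇑(footHom β⁻¹)) ∘ ⇑(footHom β) = c := by ext; simp
    have e' : strandPerm β (strandPerm β⁻¹ i) = i := by simp [strandPerm]
    rw [e, e'] at h
    have m := forget_mul c β⁻¹ β
    rw [inv_mul_cancel, forget_one] at m
    rw [eq_inv_of_mul_eq_one_left m.symm, ← h]
    simp [strandPerm]

theorem polesBelow_cableColors (c : ℕ → Color) (i x : ℕ) :
    polesBelow (cableColors c i) x =
      if x ≤ i then polesBelow c x
      else polesBelow c (x - 1) + if c i = Color.pole then 1 else 0 := by
  induction x with
  | zero => simp [polesBelow]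
  | succ x ih =>
    rw [polesBelow_succ, ih]
    rcases lt_trichotomy x i with h | rfl | h
    · simp only [cableColors, if_pos h.le, if_pos (show x + 1 ≤ i by omega), polesBelow_succ]
    · simp [cableColors]
    · obtain ⟨y, rfl⟩ : ∃ y, x = y + 1 := ⟨x - 1, by omega⟩
      simp only [cableColors, if_neg (show ¬ y + 1 ≤ i by omega),
        if_neg (show ¬ y + 1 + 1 ≤ i by omega), Nat.add_sub_cancel, polesBelow_succ c y]
      omega

theorem cableColors_permute (c : ℕ → Color) (i : ℕ) (β : BraidInf) :
    cableColors c i ∘ footHom (cable i β) =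
      cableColors (c ∘ footHom β) (strandPerm β i) := by
  ext x
  obtain ⟨y, rfl⟩ := (cablePerm i (strandPerm β)).surjective x
  rw [Function.comp_apply, footHom_cable, Equiv.Perm.inv_def, Equiv.symm_apply_apply, cablePerm_apply]
  simp only [cableColors, footHom_eq, Function.comp_apply]
  split_ifs <;> simp <;> grind

theorem forget_cableVal (c : ℕ → Color) (i k : ℕ) :
    forget (cableColors c i) (cableVal k i) =
      if c i = Color.pole then cable (polesBelow c i) (forgetVal gen k c)
      else forgetVal gen k c := by
  have fm : ∀ (d : ℕ → Color) (j k : ℕ), forget d (gen j * gen k) =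
      forgetVal gen j d * forgetVal gen k (permuteColors j d) := by
    intro d j k
    rw [forget_mul, forget_gen, forget_gen]
    simp [permuteColors]
  have e : k + 1 + 1 = k + 2 := rfl
  rcases lt_trichotomy i k with h | rfl | h
  · rw [cableVal_lt h, forget_gen]
    have a1 : cableColors c i (k + 1) = c k := by simp [cableColors, show ¬ k + 1 ≤ i by omega]
    have a2 : cableColors c i (k + 2) = c (k + 1) := by
      simp [cableColors, show ¬ k + 2 ≤ i by omega]
    simp only [forgetVal, e, a1, a2, polesBelow_cableColors, if_neg (show ¬ k + 1 ≤ i by omega),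
      Nat.add_sub_cancel]
    by_cases hi : c i = Color.pole <;> by_cases hk : c k = Color.pole ∧ c (k + 1) = Color.pole <;>
      simp [hi, hk, cable_one, cable_gen]
    exact (cableVal_lt (Nat.count_strict_mono hi h)).symm
  · rw [cableVal_self, fm]
    have a0 : cableColors c i i = c i := by simp [cableColors]
    have a1 : cableColors c i (i + 1) = c i := by simp [cableColors]
    have a2 : cableColors c i (i + 2) = c (i + 1) := by simp [cableColors]
    have b0 : permuteColors (i + 1) (cableColors c i) i = c i := by
      rw [permuteColors_ne (by omega) (by omega), a0]
    have b1 : permuteColors (i + 1) (cableColors c i) (i + 1) = c (i + 1) := by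
      rw [permuteColors_self, a2]
    simp only [forgetVal, e, a1, a2, b0, b1, polesBelow_permute_le (show i ≤ i + 1 by omega),
      polesBelow_cableColors, if_neg (show ¬ i + 1 ≤ i by omega), Nat.add_sub_cancel]
    by_cases hi : c i = Color.pole <;> by_cases hk : c (i + 1) = Color.pole <;>
      simp [hi, hk, cable_one, cable_gen, cableVal_self]
  · rcases (show i = k + 1 ∨ k + 1 < i by omega) with rfl | h
    · rw [cableVal_succ, fm]
      have a0 : cableColors c (k + 1) k = c k := by simp [cableColors]
      have a1 : cableColors c (k + 1) (k + 1) = c (k + 1) := by simp [cableColors]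
      have a2 : cableColors c (k + 1) (k + 2) = c (k + 1) := by simp [cableColors]
      have b1 : permuteColors k (cableColors c (k + 1)) (k + 1) = c k := by
        rw [permuteColors_succ, a0]
      have b0 : permuteColors k (cableColors c (k + 1)) k = c (k + 1) := by
        rw [permuteColors_self, a1]
      have b2 : permuteColors k (cableColors c (k + 1)) (k + 2) = c (k + 1) := by
        rw [permuteColors_ne (by omega) (by omega), a2]
      simp only [forgetVal, e, a0, a1, b0, b1, b2, polesBelow_succ, polesBelow_permute_le le_rfl,
        polesBelow_cableColors, if_pos (show k ≤ k + 1 by omega)]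
      by_cases hi : c (k + 1) = Color.pole <;> by_cases hk : c k = Color.pole <;>
        simp [hi, hk, cable_one, cable_gen, cableVal_succ]
    · rw [cableVal_gt h, forget_gen]
      have a1 : cableColors c i k = c k := by simp [cableColors, show k ≤ i by omega]
      have a2 : cableColors c i (k + 1) = c (k + 1) := by
        simp [cableColors, show k + 1 ≤ i by omega]
      simp only [forgetVal, a1, a2, polesBelow_cableColors, if_pos (show k ≤ i by omega)]
      by_cases hi : c i = Color.pole <;>
        by_cases hk : c k = Color.pole ∧ c (k + 1) = Color.pole <;>
        simp [hi, hk, cable_one, cable_gen]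
      exact (cableVal_gt (polesBelow_add_two_le h hk.1 hk.2)).symm

theorem forget_cable (c : ℕ → Color) (i : ℕ) (β : BraidInf) :
    forget (cableColors c i) (cable i β) =
      if c i = Color.pole then cable (polesBelow c i) (forget c β) else forget c β := by
  refine cocycle_ext
    (act := fun (p : (ℕ → Color) × ℕ) β => (p.1 ∘ footHom β, strandPerm β p.2))
    (F := fun p β => forget (cableColors p.1 p.2) (cable p.2 β))
    (G := fun p β => if p.1 p.2 = Color.pole then cable (polesBelow p.1 p.2) (forget p.1 β)
      else forget p.1 β)
    ?_ ?_ ?_ ?_ ?_ (c, i) β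
  · rintro ⟨c, i⟩ β γ
    simp only [strandPerm_mul, Equiv.trans_apply, Prod.mk.injEq, and_true]
    ext; simp
  · rintro ⟨c, i⟩; simp [strandPerm]
  · rintro ⟨c, i⟩ β γ
    dsimp only
    rw [cable_mul, forget_mul, cableColors_permute]
  · rintro ⟨c, i⟩ β γ
    dsimp only
    have e : (c ∘ footHom β) (strandPerm β i) = c i := by simp [strandPerm]
    simp only [e, forget_mul]
    split_ifs with h
    · rw [cable_mul, forget_perm c i h]
    · rfl
  · rintro ⟨c, i⟩ k
    dsimp only
    simp only [cable_gen, forget_gen]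
    exact forget_cableVal c i k

/-- The coloring after making position `i` blue. -/
def recolor (c : ℕ → Color) (i : ℕ) : ℕ → Color := Function.update c i Color.strand

theorem recolor_of_strand {c : ℕ → Color} {i : ℕ} (h : c i ≠ Color.pole) : recolor c i = c := by
  have : c i = Color.strand := by cases hc : c i <;> simp_all
  rw [recolor, ← this, Function.update_eq_self]

theorem polesBelow_recolor (c : ℕ → Color) (i n : ℕ) (hi : c i = Color.pole) :
    polesBelow (recolor c i) n + (if i < n then 1 else 0) = polesBelow c n := by
  induction n with
  | zero => simp [polesBelow]
  | succ n ih =>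
    rw [polesBelow_succ, polesBelow_succ, ← ih]
    rcases lt_trichotomy i n with h | rfl | h
    · simp [recolor, h.ne', h, show i < n + 1 by omega]; omega
    · simp [recolor, hi]
    · simp [recolor, h.ne, show ¬ i < n by omega, show ¬ i < n + 1 by omega]

theorem polesBelow_all (n : ℕ) : polesBelow (fun _ => Color.pole) n = n := by
  induction n with
  | zero => rfl
  | succ n ih => rw [polesBelow_succ, ih]; simp

theorem recolor_permute (c : ℕ → Color) (i : ℕ) (β : BraidInf) :
    recolor c i ∘ footHom β = recolor (c ∘ footHom β) (strandPerm β i) := by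
  ext x
  obtain ⟨y, rfl⟩ := (strandPerm β).surjective x
  simp only [recolor, Function.comp_apply, Function.update_apply, EmbeddingLike.apply_eq_iff_eq,
    footHom_eq, Equiv.Perm.inv_def, Equiv.symm_apply_apply]

theorem forgetVal_recolor (c : ℕ → Color) (i k : ℕ) (hi : c i = Color.pole) :
    forgetVal gen k (recolor c i) =
      forget (recolor (fun _ => Color.pole) (polesBelow c i)) (forgetVal gen k c) := by
  have hk := polesBelow_recolor c i k hi
  by_cases h : c k = Color.pole ∧ c (k + 1) = Color.pole
  · have hv : forgetVal gen k c = gen (polesBelow c k) := if_pos h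
    have hr := polesBelow_recolor (fun _ => Color.pole) (polesBelow c i) (polesBelow c k) rfl
    rw [polesBelow_all] at hr
    rw [hv, forget_gen]
    rcases lt_trichotomy i k with hik | rfl | hik
    · have : polesBelow c i < polesBelow c k := Nat.count_strict_mono hi hik
      rw [if_pos this] at hr
      rw [if_pos hik] at hk
      simp only [forgetVal, recolor, Function.update_apply]
      rw [if_neg (show k ≠ i by omega), if_neg (show k + 1 ≠ i by omega), if_pos h,
        if_neg (show polesBelow c k ≠ polesBelow c i by omega),
        if_neg (show polesBelow c k + 1 ≠ polesBelow c i by omega), if_pos ⟨rfl, rfl⟩]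
      congr 1
      simp only [recolor] at hk hr
      omega
    · simp [forgetVal, recolor]
    · rcases (show i = k + 1 ∨ k + 1 < i by omega) with rfl | hik'
      · simp [forgetVal, recolor, polesBelow_succ, h.1]
      · have := polesBelow_add_two_le (k := i) hik' h.1 h.2
        rw [if_neg (by omega)] at hr
        rw [if_neg (by omega)] at hk
        simp only [forgetVal, recolor, Function.update_apply]
        rw [if_neg (show k ≠ i by omega), if_neg (show k + 1 ≠ i by omega), if_pos h,
          if_neg (show polesBelow c k ≠ polesBelow c i by omega),
          if_neg (show polesBelow c k + 1 ≠ polesBelow c i by omega), if_pos ⟨rfl, rfl⟩]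
        congr 1
        simp only [recolor] at hk hr
        omega
  · have hv : forgetVal gen k c = 1 := if_neg h
    rw [hv, forget_one, forgetVal, if_neg]
    intro h'
    apply h
    simp only [recolor, Function.update_apply] at h'
    grind

theorem forget_recolor (c : ℕ → Color) (i : ℕ) (β : BraidInf) :
    forget (recolor c i) β =
      if c i = Color.pole then
        forget (recolor (fun _ => Color.pole) (polesBelow c i)) (forget c β)
      else forget c β := by
  refine cocycle_ext
    (act := fun (p : (ℕ → Color) × ℕ) β => (p.1 ∘ footHom β, strandPerm β p.2))
    (F := fun p β => forget (recolor p.1 p.2) β)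
    (G := fun p β => if p.1 p.2 = Color.pole then
        forget (recolor (fun _ => Color.pole) (polesBelow p.1 p.2)) (forget p.1 β)
      else forget p.1 β)
    ?_ ?_ ?_ ?_ ?_ (c, i) β
  · rintro ⟨c, i⟩ β γ
    simp only [strandPerm_mul, Equiv.trans_apply, Prod.mk.injEq, and_true]
    ext; simp
  · rintro ⟨c, i⟩; simp [strandPerm]
  · rintro ⟨c, i⟩ β γ
    dsimp only
    rw [forget_mul, recolor_permute]
  · rintro ⟨c, i⟩ β γ
    dsimp only
    have e : (c ∘ footHom β) (strandPerm β i) = c i := by simp [strandPerm]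
    simp only [e, forget_mul]
    split_ifs with h
    · rw [recolor_permute, forget_perm c i h]; rfl
    · rfl
  · rintro ⟨c, i⟩ k
    simp only [forget_gen]
    split_ifs with h
    · exact forgetVal_recolor c i k h
    · rw [recolor_of_strand h]

theorem polesBelow_shiftColors (d : Color) (c : ℕ → Color) (n : ℕ) :
    polesBelow (shiftColors d c) (n + 1) =
      polesBelow c n + if d = Color.pole then 1 else 0 := by
  induction n with
  | zero => rw [polesBelow_succ]; rfl
  | succ n ih =>
    rw [polesBelow_succ, ih, polesBelow_succ, show shiftColors d c (n + 1) = c n from rfl]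
    omega

theorem shiftColors_permute (d : Color) (c : ℕ → Color) (β : BraidInf) :
    shiftColors d c ∘ footHom (shift β) = shiftColors d (c ∘ footHom β) := by
  ext x
  obtain ⟨y, rfl⟩ := (shiftPerm (strandPerm β)).surjective x
  rw [Function.comp_apply, footHom_eq, strandPerm_shift, Equiv.Perm.inv_def,
    Equiv.symm_apply_apply]
  cases y <;> simp [shiftColors, strandPerm]

theorem forget_shift (d : Color) (c : ℕ → Color) (β : BraidInf) :
    forget (shiftColors d c) (shift β) =
      if d = Color.pole then shift (forget c β) else forget c β := by
  refine cocycle_ext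
    (act := fun (c : ℕ → Color) β => c ∘ footHom β)
    (F := fun c β => forget (shiftColors d c) (shift β))
    (G := fun c β => if d = Color.pole then shift (forget c β) else forget c β)
    ?_ ?_ ?_ ?_ ?_ c β
  · intro c β γ; ext; simp
  · intro c; simp
  · intro c β γ
    rw [map_mul, forget_mul, shiftColors_permute]
  · intro c β γ
    simp only [forget_mul]
    split_ifs <;> simp
  · intro c k
    simp only [shift_gen, forget_gen, forgetVal, polesBelow_shiftColors]
    have e1 : shiftColors d c (k + 1) = c k := rfl
    have e2 : shiftColors d c (k + 1 + 1) = c (k + 1) := rfl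
    rw [e1, e2]
    by_cases h : c k = Color.pole ∧ c (k + 1) = Color.pole <;> by_cases hd : d = Color.pole <;>
      simp [h, hd]

theorem gen_mem {l k : ℕ} (h : k + 1 < l) : gen k ∈ braidSubgroup l :=
  Subgroup.subset_closure ⟨k, h, rfl⟩

theorem strandPerm_inv (β : BraidInf) : strandPerm β⁻¹ = (strandPerm β)⁻¹ := by
  simp [strandPerm]

theorem strandPerm_of_le {l : ℕ} {β : BraidInf} (hβ : β ∈ braidSubgroup l) {i : ℕ} (hi : l ≤ i) :
    strandPerm β i = i := by
  induction hβ using Subgroup.closure_induction with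
  | mem x hx => obtain ⟨k, hk, rfl⟩ := hx; rw [strandPerm_gen]; exact swap_gt (by omega)
  | one => simp [strandPerm]
  | mul x y _ _ hx hy => rw [strandPerm_mul, Equiv.trans_apply, hx, hy]
  | inv x _ hx => rw [strandPerm_inv, Equiv.Perm.inv_eq_iff_eq, hx]

theorem strandPerm_lt {l : ℕ} {β : BraidInf} (hβ : β ∈ braidSubgroup l) {i : ℕ} (hi : i < l) :
    strandPerm β i < l := by
  by_contra h
  have := strandPerm_of_le hβ (not_lt.mp h)
  have := (strandPerm β).injective this
  omega

theorem cable_inv (i : ℕ) (β : BraidInf) :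
    cable i β⁻¹ = (cable (strandPerm β⁻¹ i) β)⁻¹ := by
  have m := cable_mul i β⁻¹ β
  rw [inv_mul_cancel, cable_one] at m
  exact eq_inv_of_mul_eq_one_left m.symm

theorem forget_inv (c : ℕ → Color) (β : BraidInf) :
    forget c β⁻¹ = (forget (c ∘ footHom β⁻¹) β)⁻¹ := by
  have m := forget_mul c β⁻¹ β
  rw [inv_mul_cancel, forget_one] at m
  exact eq_inv_of_mul_eq_one_left m.symm

theorem cable_mem {l : ℕ} {β : BraidInf} (hβ : β ∈ braidSubgroup l) (i : ℕ) :
    cable i β ∈ braidSubgroup (l + 1) := by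
  induction hβ using Subgroup.closure_induction generalizing i with
  | mem x hx =>
    obtain ⟨k, hk, rfl⟩ := hx
    have h1 : gen k ∈ braidSubgroup (l + 1) := gen_mem (by omega)
    have h2 : gen (k + 1) ∈ braidSubgroup (l + 1) := gen_mem (by omega)
    rw [cable_gen, cableVal]
    split_ifs
    · exact h2
    · exact mul_mem h2 h1
    · exact mul_mem h1 h2
    · exact h1
  | one => rw [cable_one]; exact one_mem _
  | mul x y _ _ hx hy => rw [cable_mul]; exact mul_mem (hx _) (hy _)
  | inv x _ hx => rw [cable_inv]; exact inv_mem (hx _)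

theorem shift_mem {l : ℕ} {β : BraidInf} (hβ : β ∈ braidSubgroup l) :
    shift β ∈ braidSubgroup (l + 1) := by
  induction hβ using Subgroup.closure_induction with
  | mem x hx => obtain ⟨k, hk, rfl⟩ := hx; rw [shift_gen]; exact gen_mem (by omega)
  | one => rw [map_one]; exact one_mem _
  | mul x y _ _ hx hy => rw [map_mul]; exact mul_mem hx hy
  | inv x _ hx => rw [map_inv]; exact inv_mem hx

theorem braidSubgroup_mono {l l' : ℕ} (h : l ≤ l') : braidSubgroup l ≤ braidSubgroup l' :=
  Subgroup.closure_mono fun _ ⟨k, hk, e⟩ => ⟨k, by omega, e⟩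

theorem forget_congr {l : ℕ} {β : BraidInf} (hβ : β ∈ braidSubgroup l) {c c' : ℕ → Color}
    (h : ∀ i < l, c i = c' i) : forget c β = forget c' β := by
  have key : ∀ {β : BraidInf}, β ∈ braidSubgroup l → ∀ {c c' : ℕ → Color},
      (∀ i < l, c i = c' i) → ∀ i < l, (c ∘ footHom β) i = (c' ∘ footHom β) i := by
    intro β hβ c c' h i hi
    refine h _ ?_
    have := strandPerm_lt (inv_mem hβ) hi
    rwa [strandPerm_inv, ← footHom_eq] at this
  induction hβ using Subgroup.closure_induction generalizing c c' with
  | mem x hx =>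
    obtain ⟨k, hk, rfl⟩ := hx
    rw [forget_gen, forget_gen, forgetVal, forgetVal, h k (by omega), h (k + 1) (by omega),
      polesBelow_congr fun i hi => h i (by omega)]
  | one => rw [forget_one, forget_one]
  | mul x y hx hy ihx ihy =>
    rw [forget_mul, forget_mul, ihx h, ihy (key hx h)]
  | inv x hx ih =>
    rw [forget_inv, forget_inv, ih (key (inv_mem hx) h)]

/-- The color of the `i`-th letter of the word `o` (blue beyond the end, where nothing happens). -/
def colorAt (o : List Color) (i : ℕ) : Color := o.getD i Color.strand

/-- `σ` is a mixed permutation from `o` to `o'`: it permutes the positions `0, …, l - 1`, where `l`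
is the length of both words, it respects the colors, and it keeps the order of the poles, that is, it
becomes the trivial permutation when the blue letters are forgotten. -/
structure IsMixedPerm (o o' : List Color) (σ : Equiv.Perm ℕ) : Prop where
  length_eq : o'.length = o.length
  fix : ∀ i, o.length ≤ i → σ i = i
  color : ∀ i, colorAt o' (σ i) = colorAt o i
  mono : ∀ i j, colorAt o i = Color.pole → colorAt o j = Color.pole → i < j → σ i < σ j

/-- `β` is a mixed braid from `o` (bottom) to `o'` (top): a braid on `l` strands, where `l` is the
length of both words, whose strands join equal colors, and which becomes the trivial braid when the
blue strands are forgotten. (A braid is trivial in `B_∞` if and only if it is trivial in `B_m`, by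
`toInf_injective`.) -/
structure IsMixedBraid (o o' : List Color) (β : BraidInf) : Prop where
  mem : β ∈ braidSubgroup o.length
  length_eq : o'.length = o.length
  color : ∀ i, colorAt o' (strandPerm β i) = colorAt o i
  forget_eq : forget (colorAt o) β = 1

/-- A morphism from `o` to `o'` in the category **MB** of mixed braids: a pair of a mixed
permutation and a `ℚ`-linear combination of mixed braids with this underlying permutation. -/
@[ext]
structure MBHom (o o' : List Color) where
  perm : Equiv.Perm ℕ
  isMixedPerm : IsMixedPerm o o' perm
  comb : MonoidAlgebra ℚ BraidInf
  isMixedBraid : ∀ β ∈ comb.coeff.support, IsMixedBraid o o' β ∧ strandPerm β = perm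

theorem IsMixedPerm.refl (o : List Color) : IsMixedPerm o o (Equiv.refl ℕ) where
  length_eq := rfl
  fix _ _ := rfl
  color _ := rfl
  mono _ _ _ _ h := h

theorem IsMixedPerm.trans {o o' o'' : List Color} {σ τ : Equiv.Perm ℕ} (h : IsMixedPerm o o' σ)
    (h' : IsMixedPerm o' o'' τ) : IsMixedPerm o o'' (σ.trans τ) where
  length_eq := h'.length_eq.trans h.length_eq
  fix i hi := by
    rw [Equiv.trans_apply, h.fix i hi, h'.fix i (by rwa [h.length_eq])]
  color i := by rw [Equiv.trans_apply, h'.color, h.color]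
  mono i j hi hj hij :=
    h'.mono _ _ (by rw [h.color, hi]) (by rw [h.color, hj]) (h.mono i j hi hj hij)

theorem IsMixedBraid.one (o : List Color) : IsMixedBraid o o 1 where
  mem := one_mem _
  length_eq := rfl
  color _ := by simp [strandPerm]
  forget_eq := forget_one _

theorem colorAt_comp {o o' : List Color} {β : BraidInf}
    (h : ∀ i, colorAt o' (strandPerm β i) = colorAt o i) :
    colorAt o ∘ footHom β = colorAt o' := by
  ext i
  rw [Function.comp_apply, ← h]
  simp [strandPerm]

theorem IsMixedBraid.mul {o o' o'' : List Color} {β γ : BraidInf} (h : IsMixedBraid o o' β)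
    (h' : IsMixedBraid o' o'' γ) : IsMixedBraid o o'' (β * γ) where
  mem := mul_mem h.mem (h.length_eq ▸ h'.mem)
  length_eq := h'.length_eq.trans h.length_eq
  color i := by rw [strandPerm_mul, Equiv.trans_apply, h'.color, h.color]
  forget_eq := by
    rw [forget_mul, colorAt_comp h.color, h.forget_eq, h'.forget_eq, one_mul]

theorem exists_of_mem_support_mul {x y : MonoidAlgebra ℚ BraidInf} {β : BraidInf}
    (h : β ∈ (x * y).coeff.support) :
    ∃ β₁ ∈ x.coeff.support, ∃ β₂ ∈ y.coeff.support, β₁ * β₂ = β := by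
  classical
  exact Finset.mem_mul.mp (MonoidAlgebra.support_coeff_mul_subset x y h)

theorem exists_of_mem_support_mapDomain {f : BraidInf → BraidInf} {x : MonoidAlgebra ℚ BraidInf}
    {β : BraidInf} (h : β ∈ (x.mapDomain f).coeff.support) :
    ∃ γ ∈ x.coeff.support, f γ = β := by
  classical
  exact Finset.mem_image.mp (Finsupp.mapDomain_support h)

theorem eq_of_mem_support_single {β γ : BraidInf} {q : ℚ}
    (h : β ∈ (MonoidAlgebra.single γ q).coeff.support) : β = γ :=
  Finset.mem_singleton.mp (Finsupp.support_single_subset h)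

/-- The identity morphism: the trivial braid. -/
noncomputable def MBHom.id (o : List Color) : MBHom o o where
  perm := Equiv.refl ℕ
  isMixedPerm := .refl o
  comb := 1
  isMixedBraid β h := by
    obtain rfl := eq_of_mem_support_single h
    exact ⟨.one o, by ext; simp [strandPerm]⟩

/-- Composition: the bilinear extension of the product of braids, in the group algebra. -/
noncomputable def MBHom.comp {o o' o'' : List Color} (f : MBHom o o') (g : MBHom o' o'') :
    MBHom o o'' where
  perm := f.perm.trans g.perm
  isMixedPerm := f.isMixedPerm.trans g.isMixedPerm
  comb := f.comb * g.comb
  isMixedBraid β h := by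
    obtain ⟨β₁, h₁, β₂, h₂, rfl⟩ := exists_of_mem_support_mul h
    have h₁ := f.isMixedBraid β₁ h₁
    have h₂ := g.isMixedBraid β₂ h₂
    exact ⟨h₁.1.mul h₂.1, by rw [strandPerm_mul, h₁.2, h₂.2]⟩

/-- Parenthesized words in the two letters pole and strand, including the empty word `1`. The
product `O * O'` is `(O)(O')`, and the empty word is its unit. -/
abbrev Par : Type := WithOne (FreeMagma Color)

namespace Par

/-- The word with one letter. -/
def letter (c : Color) : Par := (FreeMagma.of c : FreeMagma Color)

/-- Forgetting the parenthesization of a nonempty parenthesized word. -/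
def treeWord : FreeMagma Color → List Color
  | .of c => [c]
  | .mul a b => treeWord a ++ treeWord b

/-- Forgetting the parenthesization. -/
def word (O : Par) : List Color := WithOne.recOneCoe [] treeWord O

/-- Forgetting the blue letters of a nonempty parenthesized word. -/
def treeSkeleton : FreeMagma Color → Par
  | .of Color.pole => letter Color.pole
  | .of Color.strand => 1
  | .mul a b => treeSkeleton a * treeSkeleton b

/-- The parenthesized word in poles only that is obtained by forgetting the blue letters. -/
def skeleton (O : Par) : Par := WithOne.recOneCoe 1 treeSkeleton O

/-- Replacing the letter `c` at position `i` by `F c`. -/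
def treeReplace (F : Color → FreeMagma Color) : FreeMagma Color → ℕ → FreeMagma Color
  | .of c, 0 => F c
  | .of c, _ + 1 => .of c
  | .mul a b, i =>
    if i < (treeWord a).length then .mul (treeReplace F a i) b
    else .mul a (treeReplace F b (i - (treeWord a).length))

/-- Replacing the letter `c` at position `i` by the parenthesized word `F c`. -/
def replace (F : Color → FreeMagma Color) (O : Par) (i : ℕ) : Par :=
  WithOne.recOneCoe 1 (fun t => (treeReplace F t i : FreeMagma Color)) O

/-- Replacing the letter `c` at position `i` by `(c c)`. -/
def double (O : Par) (i : ℕ) : Par := O.replace (fun c => .mul (.of c) (.of c)) i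

/-- Changing the letter at position `i` to a strand. -/
def toStrand (O : Par) (i : ℕ) : Par := O.replace (fun _ => .of Color.strand) i

end Par

/-- A morphism in the category **PaMB** of parenthesized mixed braids: a morphism in **MB** between
the underlying words, which exists only if the two parenthesized words of poles agree. -/
@[ext]
structure PaMBHom (O O' : Par) extends MBHom O.word O'.word where
  skeleton_eq : O.skeleton = O'.skeleton

/-- The category **PaMB** of parenthesized mixed braids. In `f ≫ g` the morphism `g` is on top. -/
noncomputable instance : Category Par where
  Hom := PaMBHom
  id O := { MBHom.id O.word with skeleton_eq := rfl }
  comp f g := { f.toMBHom.comp g.toMBHom with skeleton_eq := f.skeleton_eq.trans g.skeleton_eq }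
  id_comp f := by
    apply PaMBHom.ext
    · ext; rfl
    · exact one_mul _
  comp_id f := by
    apply PaMBHom.ext
    · ext; rfl
    · exact mul_one _
  assoc f g h := by
    apply PaMBHom.ext
    · ext; rfl
    · exact mul_assoc _ _ _

namespace Par

theorem word_mul (O O' : Par) : (O * O').word = O.word ++ O'.word := by
  induction O using WithOne.recOneCoe with
  | one => simp [word]
  | coe a =>
    induction O' using WithOne.recOneCoe with
    | one => simp [word]
    | coe b => rfl

theorem skeleton_mul (O O' : Par) : (O * O').skeleton = O.skeleton * O'.skeleton := by
  induction O using WithOne.recOneCoe with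
  | one => simp [skeleton]
  | coe a =>
    induction O' using WithOne.recOneCoe with
    | one => simp [skeleton]
    | coe b => rfl

theorem word_letter (c : Color) : (letter c).word = [c] := rfl

end Par

theorem colorAt_cons (d : Color) (o : List Color) : colorAt (d :: o) = shiftColors d (colorAt o) := by
  ext i
  cases i <;> simp [colorAt, shiftColors]

theorem colorAt_append_left {o o' : List Color} {i : ℕ} (h : i < o.length) :
    colorAt (o ++ o') i = colorAt o i := by
  simp [colorAt, List.getElem?_append_left h]

theorem colorAt_append_right {o o' : List Color} {i : ℕ} (h : o.length ≤ i) :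
    colorAt (o ++ o') i = colorAt o' (i - o.length) := by
  simp [colorAt, List.getElem?_append_right h]

theorem colorAt_of_le {o : List Color} {i : ℕ} (h : o.length ≤ i) :
    colorAt o i = Color.strand := by
  simp [colorAt, h]

theorem lt_of_colorAt {o : List Color} {i : ℕ} (h : colorAt o i = Color.pole) : i < o.length := by
  by_contra h'
  rw [colorAt_of_le (not_lt.mp h')] at h
  cases h

/-- Replacing the letter `c` at position `i` of a word by the word `F c`. -/
def wordReplace (F : Color → List Color) : List Color → ℕ → List Color
  | [], _ => []
  | c :: o, 0 => F c ++ o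
  | c :: o, i + 1 => c :: wordReplace F o i

theorem wordReplace_append (F : Color → List Color) (o o' : List Color) (i : ℕ) :
    wordReplace F (o ++ o') i =
      if i < o.length then wordReplace F o i ++ o' else o ++ wordReplace F o' (i - o.length) := by
  induction o generalizing i with
  | nil => simp
  | cons c o ih =>
    cases i with
    | zero => simp [wordReplace]
    | succ i =>
      simp only [List.cons_append, wordReplace, ih, List.length_cons, Nat.add_lt_add_iff_right,
        Nat.add_sub_add_right]
      split_ifs <;> rfl

namespace Par

theorem treeWord_replace (F : Color → FreeMagma Color) (t : FreeMagma Color) (i : ℕ) :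
    treeWord (treeReplace F t i) = wordReplace (fun c => treeWord (F c)) (treeWord t) i := by
  induction t using FreeMagma.rec generalizing i with
  | of c => cases i <;> simp [treeReplace, treeWord, wordReplace]
  | mul a b iha ihb =>
    simp only [treeReplace, treeWord, wordReplace_append]
    split_ifs <;> simp [treeWord, iha, ihb]

theorem word_replace (F : Color → FreeMagma Color) (O : Par) (i : ℕ) :
    (O.replace F i).word = wordReplace (fun c => treeWord (F c)) O.word i := by
  induction O using WithOne.recOneCoe with
  | one => rfl
  | coe t => exact treeWord_replace F t i

end Par

theorem wordDouble {o : List Color} {i : ℕ} (h : i < o.length) :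
    colorAt (wordReplace (fun c => [c, c]) o i) = cableColors (colorAt o) i := by
  induction o generalizing i with
  | nil => simp at h
  | cons c o ih =>
    ext x
    cases i with
    | zero =>
      simp only [wordReplace, List.cons_append, List.nil_append, colorAt_cons, cableColors]
      rcases x with _ | _ | x <;> simp [shiftColors]
    | succ i =>
      rw [wordReplace, colorAt_cons, colorAt_cons, ih (by simpa using h)]
      rcases x with _ | x
      · simp [shiftColors, cableColors]
      · simp only [shiftColors, cableColors]
        rcases x with _ | x
        · simp
        · by_cases hx : x + 1 ≤ i
          · simp [hx]
          · simp [hx]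

theorem length_wordDouble {o : List Color} {i : ℕ} (h : i < o.length) :
    (wordReplace (fun c => [c, c]) o i).length = o.length + 1 := by
  induction o generalizing i with
  | nil => simp at h
  | cons c o ih =>
    cases i with
    | zero => simp [wordReplace]
    | succ i => simp [wordReplace, ih (show i < o.length by simpa using h)]

theorem wordToStrand (o : List Color) (i : ℕ) :
    colorAt (wordReplace (fun _ => [Color.strand]) o i) = recolor (colorAt o) i := by
  induction o generalizing i with
  | nil => rw [recolor_of_strand (by simp [colorAt])]; rfl
  | cons c o ih =>
    ext x
    cases i with
    | zero =>
      simp only [wordReplace, List.cons_append, List.nil_append, colorAt_cons]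
      cases x <;> simp [shiftColors, recolor]
    | succ i =>
      rw [wordReplace, colorAt_cons, colorAt_cons, ih]
      cases x <;> simp [shiftColors, recolor, Function.update_apply]

theorem length_wordToStrand (o : List Color) (i : ℕ) :
    (wordReplace (fun _ => [Color.strand]) o i).length = o.length := by
  induction o generalizing i with
  | nil => rfl
  | cons c o ih => cases i <;> simp [wordReplace, ih]

namespace IsMixedPerm

variable {o o' : List Color} {σ : Equiv.Perm ℕ}

theorem lt (h : IsMixedPerm o o' σ) {i : ℕ} (hi : i < o.length) : σ i < o.length := by
  by_contra h'
  have := σ.injective (h.fix _ (not_lt.mp h'))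
  omega

theorem pole_lt_iff (h : IsMixedPerm o o' σ) {i j : ℕ} (hi : colorAt o i = Color.pole)
    (hj : colorAt o j = Color.pole) : σ i < σ j ↔ i < j := by
  refine ⟨fun hij => ?_, h.mono i j hi hj⟩
  by_contra hn
  rcases (not_lt.mp hn).lt_or_eq with h' | rfl
  · exact absurd (h.mono j i hj hi h') (by omega)
  · omega

theorem polesBelow_eq (h : IsMixedPerm o o' σ) {i : ℕ} (hi : colorAt o i = Color.pole) :
    polesBelow (colorAt o') (σ i) = polesBelow (colorAt o) i := by
  rw [polesBelow, polesBelow, Nat.count_eq_card_filter_range, Nat.count_eq_card_filter_range]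
  symm
  refine Finset.card_bij (fun j _ => σ j) ?_ (fun a _ b _ e => σ.injective e) ?_
  · intro j hj
    simp only [Finset.mem_filter, Finset.mem_range] at hj ⊢
    exact ⟨h.mono j i hj.2 hi hj.1, by rw [h.color, hj.2]⟩
  · intro j hj
    simp only [Finset.mem_filter, Finset.mem_range] at hj
    have hc : colorAt o (σ.symm j) = Color.pole := by
      rw [← h.color, Equiv.apply_symm_apply, hj.2]
    refine ⟨σ.symm j, ?_, by simp⟩
    simp only [Finset.mem_filter, Finset.mem_range]
    exact ⟨(h.pole_lt_iff hc hi).mp (by simpa using hj.1), hc⟩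

theorem cons (h : IsMixedPerm o o' σ) (d : Color) :
    IsMixedPerm (d :: o) (d :: o') (shiftPerm σ) where
  length_eq := by simp [h.length_eq]
  fix i hi := by
    cases i with
    | zero => simp at hi
    | succ i => rw [shiftPerm_succ, h.fix i (by simpa using hi)]
  color i := by
    rw [colorAt_cons, colorAt_cons]
    cases i with
    | zero => rfl
    | succ i => exact h.color i
  mono i j hi hj hij := by
    rw [colorAt_cons] at hi hj
    cases j with
    | zero => omega
    | succ j =>
      cases i with
      | zero => simp
      | succ i =>
        rw [shiftPerm_succ, shiftPerm_succ]
        have := h.mono i j hi hj (by omega)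
        omega

theorem append (h : IsMixedPerm o o' σ) (d : Color) : IsMixedPerm (o ++ [d]) (o' ++ [d]) σ where
  length_eq := by simp [h.length_eq]
  fix i hi := h.fix i (by simp at hi; omega)
  color i := by
    by_cases hi : i < o.length
    · have := h.lt hi
      rw [colorAt_append_left hi, colorAt_append_left (by rwa [h.length_eq]), h.color]
    · have hi := not_lt.mp hi
      rw [h.fix i hi, colorAt_append_right hi, colorAt_append_right (by rwa [h.length_eq]),
        h.length_eq]
  mono i j hi hj hij := by
    have hj' := lt_of_colorAt hj
    rw [List.length_append, List.length_singleton] at hj'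
    have hi' : i < o.length := by omega
    rw [colorAt_append_left hi'] at hi
    by_cases hj'' : j < o.length
    · rw [colorAt_append_left hj''] at hj
      exact h.mono i j hi hj hij
    · rw [h.fix j (not_lt.mp hj'')]
      have := h.lt hi'
      omega

theorem double (h : IsMixedPerm o o' σ) {i : ℕ} (hi : i < o.length) :
    IsMixedPerm (wordReplace (fun c => [c, c]) o i) (wordReplace (fun c => [c, c]) o' (σ i))
      (cablePerm i σ) where
  length_eq := by
    rw [length_wordDouble hi, length_wordDouble (by rw [h.length_eq]; exact h.lt hi), h.length_eq]
  fix x hx := by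
    rw [length_wordDouble hi] at hx
    have := h.lt hi
    rw [cablePerm_apply, if_neg (by omega), if_neg (show ¬ x ≤ i by omega),
      h.fix (x - 1) (by omega), if_neg (by omega)]
    omega
  color x := by
    rw [wordDouble hi, wordDouble (by rw [h.length_eq]; exact h.lt hi), cablePerm_apply]
    simp only [cableColors]
    rw [← h.color]
    congr 1
    split_ifs <;> grind
  mono x y hx hy hxy := by
    rw [wordDouble hi] at hx hy
    simp only [cableColors] at hx hy
    have m1 := h.mono _ _ hx hy
    rw [cablePerm_apply, cablePerm_apply]
    have inj := σ.injective
    by_cases hx1 : x ≤ i <;> by_cases hy1 : y ≤ i <;>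
      simp only [hx1, hy1, if_true, if_false] at hx hy m1 ⊢
    · have := m1 hxy
      split_ifs <;> omega
    · rcases (show y = i + 1 ∨ i < y - 1 by omega) with rfl | h2
      · simp only [Nat.add_sub_cancel] at m1
        rcases hx1.lt_or_eq with h3 | rfl
        · have := m1 h3
          split_ifs <;> omega
        · split_ifs <;> omega
      · have := m1 (by omega)
        split_ifs <;> omega
    · omega
    · have := m1 (by omega)
      rcases (show x = i + 1 ∨ i < x - 1 by omega) with rfl | h2
      · simp only [Nat.add_sub_cancel] at this
        split_ifs <;> omega
      · have hne : σ (x - 1) ≠ σ i := fun e => by have := inj e; omega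
        split_ifs <;> omega

theorem toStrand (h : IsMixedPerm o o' σ) (i : ℕ) :
    IsMixedPerm (wordReplace (fun _ => [Color.strand]) o i)
      (wordReplace (fun _ => [Color.strand]) o' (σ i)) σ where
  length_eq := by rw [length_wordToStrand, length_wordToStrand, h.length_eq]
  fix x hx := h.fix x (by rwa [length_wordToStrand] at hx)
  color x := by
    rw [wordToStrand, wordToStrand]
    simp only [recolor, Function.update_apply, EmbeddingLike.apply_eq_iff_eq, h.color]
  mono x y hx hy hxy := by
    rw [wordToStrand] at hx hy
    simp only [recolor, Function.update_apply] at hx hy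
    split_ifs at hx hy
    exact h.mono x y hx hy hxy

end IsMixedPerm

namespace IsMixedBraid

variable {o o' : List Color} {β : BraidInf}

theorem cons (h : IsMixedBraid o o' β) (d : Color) :
    IsMixedBraid (d :: o) (d :: o') (shift β) where
  mem := shift_mem h.mem
  length_eq := by simp [h.length_eq]
  color i := by
    rw [colorAt_cons, colorAt_cons, strandPerm_shift]
    cases i with
    | zero => rfl
    | succ i => exact h.color i
  forget_eq := by
    rw [colorAt_cons, forget_shift, h.forget_eq, map_one, ite_self]

theorem append (h : IsMixedBraid o o' β) (d : Color) : IsMixedBraid (o ++ [d]) (o' ++ [d]) β where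
  mem := braidSubgroup_mono (by simp) h.mem
  length_eq := by simp [h.length_eq]
  color i := by
    by_cases hi : i < o.length
    · have := strandPerm_lt h.mem hi
      rw [colorAt_append_left hi, colorAt_append_left (by rwa [h.length_eq]), h.color]
    · have hi := not_lt.mp hi
      rw [strandPerm_of_le h.mem hi, colorAt_append_right hi,
        colorAt_append_right (by rwa [h.length_eq]), h.length_eq]
  forget_eq := by
    rw [forget_congr h.mem fun i hi => colorAt_append_left hi, h.forget_eq]

theorem double (h : IsMixedBraid o o' β) {i : ℕ} (hi : i < o.length) :
    IsMixedBraid (wordReplace (fun c => [c, c]) o i)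
      (wordReplace (fun c => [c, c]) o' (strandPerm β i)) (cable i β) where
  mem := by rw [length_wordDouble hi]; exact cable_mem h.mem i
  length_eq := by
    rw [length_wordDouble hi, length_wordDouble (by rw [h.length_eq]; exact strandPerm_lt h.mem hi),
      h.length_eq]
  color x := by
    rw [wordDouble hi, wordDouble (by rw [h.length_eq]; exact strandPerm_lt h.mem hi),
      ← colorAt_comp h.color, ← cableColors_permute]
    simp [strandPerm]
  forget_eq := by
    rw [wordDouble hi, forget_cable, h.forget_eq, cable_one, ite_self]

theorem toStrand (h : IsMixedBraid o o' β) (i : ℕ) :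
    IsMixedBraid (wordReplace (fun _ => [Color.strand]) o i)
      (wordReplace (fun _ => [Color.strand]) o' (strandPerm β i)) β where
  mem := by rw [length_wordToStrand]; exact h.mem
  length_eq := by rw [length_wordToStrand, length_wordToStrand, h.length_eq]
  color x := by
    rw [wordToStrand, wordToStrand, ← colorAt_comp h.color, ← recolor_permute]
    simp [strandPerm]
  forget_eq := by
    rw [wordToStrand, forget_recolor, h.forget_eq, forget_one, ite_self]

end IsMixedBraid

/-- The number of poles of a word. -/
def numPoles (o : List Color) : ℕ := polesBelow (colorAt o) o.length

theorem polesBelow_append_left {o o' : List Color} {i : ℕ} (h : i ≤ o.length) :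
    polesBelow (colorAt (o ++ o')) i = polesBelow (colorAt o) i :=
  polesBelow_congr fun _ hj => colorAt_append_left (by omega)

theorem polesBelow_append_right (o o' : List Color) (i : ℕ) :
    polesBelow (colorAt (o ++ o')) (o.length + i) = numPoles o + polesBelow (colorAt o') i := by
  induction i with
  | zero => exact polesBelow_append_left le_rfl
  | succ i ih =>
    rw [← add_assoc, polesBelow_succ, ih, polesBelow_succ, colorAt_append_right (by omega),
      Nat.add_sub_cancel_left]
    omega

namespace Par

/-- Replacing the `j`-th pole of a nonempty parenthesized word by `u`. -/
def treeSubst (u : Par) : FreeMagma Color → ℕ → Par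
  | .of Color.pole, 0 => u
  | .of c, _ => letter c
  | .mul a b, j =>
    if j < numPoles (treeWord a) then treeSubst u a j * (b : FreeMagma Color)
    else (a : FreeMagma Color) * treeSubst u b (j - numPoles (treeWord a))

/-- Replacing the `j`-th pole by `u`. -/
def subst (u O : Par) (j : ℕ) : Par := WithOne.recOneCoe 1 (fun t => treeSubst u t j) O

theorem subst_mul (u O O' : Par) (j : ℕ) (hj : j < numPoles (O * O').word) :
    subst u (O * O') j =
      if j < numPoles O.word then subst u O j * O' else O * subst u O' (j - numPoles O.word) := by
  induction O using WithOne.recOneCoe with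
  | one =>
    have h0 : numPoles (1 : Par).word = 0 := rfl
    simp [h0]
  | coe a =>
    induction O' using WithOne.recOneCoe with
    | one => rw [mul_one] at hj; rw [mul_one, mul_one, if_pos hj]
    | coe b => rfl

theorem numPoles_append (o o' : List Color) : numPoles (o ++ o') = numPoles o + numPoles o' := by
  rw [numPoles, List.length_append, polesBelow_append_right]; rfl

theorem numPoles_treeSkeleton (t : FreeMagma Color) :
    numPoles (treeSkeleton t).word = numPoles (treeWord t) := by
  induction t using FreeMagma.rec with
  | of c => cases c <;> rfl
  | mul a b iha ihb =>
    rw [treeSkeleton, word_mul, numPoles_append, iha, ihb, treeWord, numPoles_append]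

theorem polesBelow_lt_numPoles {o : List Color} {i : ℕ} (h : colorAt o i = Color.pole) :
    polesBelow (colorAt o) i < numPoles o :=
  Nat.count_strict_mono h (lt_of_colorAt h)

theorem treeSkeleton_replace_pole (F : Color → FreeMagma Color) (t : FreeMagma Color) (i : ℕ)
    (h : colorAt (treeWord t) i = Color.pole) :
    treeSkeleton (treeReplace F t i) =
      subst (treeSkeleton (F Color.pole)) (treeSkeleton t) (polesBelow (colorAt (treeWord t)) i) := by
  induction t using FreeMagma.rec generalizing i with
  | of c =>
    have := lt_of_colorAt h
    obtain rfl : i = 0 := by simpa [treeWord] using this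
    obtain rfl : c = Color.pole := h
    rfl
  | mul a b iha ihb =>
    have hj : polesBelow (colorAt (treeWord (a.mul b))) i <
        numPoles (treeSkeleton a * treeSkeleton b).word := by
      have := polesBelow_lt_numPoles h
      rwa [← numPoles_treeSkeleton] at this
    rw [treeSkeleton, subst_mul _ _ _ _ hj, numPoles_treeSkeleton, treeReplace]
    rw [treeWord] at h ⊢
    by_cases hi : i < (treeWord a).length
    · rw [colorAt_append_left hi] at h
      rw [if_pos hi, polesBelow_append_left hi.le, if_pos (polesBelow_lt_numPoles h), treeSkeleton,
        iha i h]
    · obtain ⟨k, rfl⟩ := Nat.exists_eq_add_of_le (not_lt.mp hi)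
      rw [colorAt_append_right (by omega), Nat.add_sub_cancel_left] at h
      rw [if_neg hi, polesBelow_append_right, if_neg (by omega), treeSkeleton,
        Nat.add_sub_cancel_left, Nat.add_sub_cancel_left, ihb k h]

theorem treeSkeleton_replace_strand (F : Color → FreeMagma Color)
    (hF : treeSkeleton (F Color.strand) = 1) (t : FreeMagma Color) (i : ℕ)
    (h : colorAt (treeWord t) i ≠ Color.pole) :
    treeSkeleton (treeReplace F t i) = treeSkeleton t := by
  induction t using FreeMagma.rec generalizing i with
  | of c =>
    cases i with
    | zero =>
      cases c with
      | pole => exact absurd rfl h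
      | strand => exact hF
    | succ i => rfl
  | mul a b iha ihb =>
    rw [treeReplace]
    rw [treeWord] at h
    by_cases hi : i < (treeWord a).length
    · rw [colorAt_append_left hi] at h
      rw [if_pos hi, treeSkeleton, iha i h, treeSkeleton]
    · rw [colorAt_append_right (not_lt.mp hi)] at h
      rw [if_neg hi, treeSkeleton, ihb _ h, treeSkeleton]

theorem skeleton_replace_eq (F : Color → FreeMagma Color)
    (hF : treeSkeleton (F Color.strand) = 1) {O O' : Par} (h : O.skeleton = O'.skeleton)
    {σ : Equiv.Perm ℕ} (hσ : IsMixedPerm O.word O'.word σ) (i : ℕ) :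
    (O.replace F i).skeleton = (O'.replace F (σ i)).skeleton := by
  have pole : ∀ (O : Par) (i : ℕ), colorAt O.word i = Color.pole → (O.replace F i).skeleton =
      subst (treeSkeleton (F Color.pole)) O.skeleton (polesBelow (colorAt O.word) i) := by
    intro O i hi
    induction O using WithOne.recOneCoe with
    | one => simp [word, colorAt] at hi
    | coe t => exact treeSkeleton_replace_pole F t i hi
  have strand : ∀ (O : Par) (i : ℕ), colorAt O.word i ≠ Color.pole →
      (O.replace F i).skeleton = O.skeleton := by
    intro O i hi
    induction O using WithOne.recOneCoe with
    | one => rfl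
    | coe t => exact treeSkeleton_replace_strand F hF t i hi
  have hc := hσ.color i
  by_cases hi : colorAt O.word i = Color.pole
  · rw [pole O i hi, pole O' (σ i) (hc.trans hi), h, hσ.polesBelow_eq hi]
  · rw [strand O i hi, strand O' (σ i) (by rwa [hc]), h]

end Par

namespace PaMB

/-- Extension operation: adding a straight pole or strand on the left, outermost. -/
noncomputable def extendLeft (c : Color) {O O' : Par} (f : O ⟶ O') :
    Par.letter c * O ⟶ Par.letter c * O' where
  perm := shiftPerm f.perm
  comb := f.comb.mapDomain shift
  isMixedPerm := by
    rw [Par.word_mul, Par.word_mul]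
    exact f.isMixedPerm.cons c
  isMixedBraid β h := by
    obtain ⟨γ, hγ, rfl⟩ := exists_of_mem_support_mapDomain h
    obtain ⟨h₁, h₂⟩ := f.isMixedBraid γ hγ
    rw [Par.word_mul, Par.word_mul]
    exact ⟨h₁.cons c, by rw [strandPerm_shift, h₂]⟩
  skeleton_eq := by rw [Par.skeleton_mul, Par.skeleton_mul, f.skeleton_eq]

/-- Extension operation: adding a straight pole or strand on the right, outermost. -/
def extendRight (c : Color) {O O' : Par} (f : O ⟶ O') :
    O * Par.letter c ⟶ O' * Par.letter c where
  perm := f.perm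
  comb := f.comb
  isMixedPerm := by
    rw [Par.word_mul, Par.word_mul]
    exact f.isMixedPerm.append c
  isMixedBraid β h := by
    obtain ⟨h₁, h₂⟩ := f.isMixedBraid β h
    rw [Par.word_mul, Par.word_mul]
    exact ⟨h₁.append c, h₂⟩
  skeleton_eq := by rw [Par.skeleton_mul, Par.skeleton_mul, f.skeleton_eq]

/-- Cabling operation: doubling the strand or pole at position `i` at the bottom. The two copies have
the color of the original and are closest to each other at both ends. -/
noncomputable def cabling {O O' : Par} (f : O ⟶ O') (i : ℕ) (hi : i < O.word.length) :
    O.double i ⟶ O'.double (f.perm i) where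
  perm := cablePerm i f.perm
  comb := f.comb.mapDomain (cable i)
  isMixedPerm := by
    rw [Par.double, Par.double, Par.word_replace, Par.word_replace]
    exact f.isMixedPerm.double hi
  isMixedBraid β h := by
    obtain ⟨γ, hγ, rfl⟩ := exists_of_mem_support_mapDomain h
    obtain ⟨h₁, h₂⟩ := f.isMixedBraid γ hγ
    rw [Par.double, Par.double, Par.word_replace, Par.word_replace, strandPerm_cable, ← h₂]
    exact ⟨h₁.double hi, rfl⟩
  skeleton_eq := Par.skeleton_replace_eq _ (mul_one 1) f.skeleton_eq f.isMixedPerm i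

/-- Changing the pole at position `i` at the bottom to a strand. -/
def poleToStrand {O O' : Par} (f : O ⟶ O') (i : ℕ) :
    O.toStrand i ⟶ O'.toStrand (f.perm i) where
  perm := f.perm
  comb := f.comb
  isMixedPerm := by
    rw [Par.toStrand, Par.toStrand, Par.word_replace, Par.word_replace]
    exact f.isMixedPerm.toStrand i
  isMixedBraid β h := by
    obtain ⟨h₁, h₂⟩ := f.isMixedBraid β h
    rw [Par.toStrand, Par.toStrand, Par.word_replace, Par.word_replace, ← h₂]
    exact ⟨h₁.toStrand i, rfl⟩
  skeleton_eq := Par.skeleton_replace_eq _ rfl f.skeleton_eq f.isMixedPerm i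

end PaMB

theorem IsMixedBraid.inv {o o' : List Color} {β : BraidInf} (h : IsMixedBraid o o' β) :
    IsMixedBraid o' o β⁻¹ where
  mem := by rw [h.length_eq]; exact inv_mem h.mem
  length_eq := h.length_eq.symm
  color i := by rw [← h.color, strandPerm_inv]; simp
  forget_eq := by
    have e : colorAt o' ∘ ⇑(footHom β⁻¹) = colorAt o := by
      rw [← colorAt_comp h.color]; ext; simp
    rw [forget_inv, e, h.forget_eq, inv_one]

theorem IsMixedBraid.isMixedPerm {o o' : List Color} {β : BraidInf} (h : IsMixedBraid o o' β) :
    IsMixedPerm o o' (strandPerm β) where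
  length_eq := h.length_eq
  fix _ hi := strandPerm_of_le h.mem hi
  color := h.color
  mono i j hi hj hij := by
    have key : ∀ i, colorAt o i = Color.pole →
        polesBelow (colorAt o') (strandPerm β i) = polesBelow (colorAt o) i := by
      intro i hi
      rw [← colorAt_comp h.color, ← forget_perm _ _ hi, h.forget_eq]
      simp [strandPerm]
    have h1 : polesBelow (colorAt o) i < polesBelow (colorAt o) j := Nat.count_strict_mono hi hij
    rw [← key i hi, ← key j hj] at h1
    by_contra hn
    have := Nat.count_monotone (fun i => colorAt o' i = Color.pole) (not_lt.mp hn)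
    exact absurd h1 (not_lt.mpr this)

namespace PaMB

/-- The morphism of **PaMB** given by one mixed braid: a parenthesized mixed braid. -/
noncomputable def ofBraid {O O' : Par} (β : BraidInf) (h : IsMixedBraid O.word O'.word β)
    (hs : O.skeleton = O'.skeleton) : O ⟶ O' where
  perm := strandPerm β
  isMixedPerm := h.isMixedPerm
  comb := MonoidAlgebra.single β 1
  isMixedBraid γ hγ := by
    obtain rfl := eq_of_mem_support_single hγ
    exact ⟨h, rfl⟩
  skeleton_eq := hs

theorem isMixedBraid_gen {a b : Color} (h : ¬ (a = Color.pole ∧ b = Color.pole)) :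
    IsMixedBraid [a, b] [b, a] (gen 0) where
  mem := gen_mem (by simp)
  length_eq := rfl
  color i := by
    rw [strandPerm_gen]
    rcases i with _ | _ | i
    · simp [colorAt]
    · simp [colorAt]
    · rw [swap_gt (by omega)]; simp [colorAt]
  forget_eq := by rw [forget_gen]; exact if_neg h

/-- The word consisting of one pole. -/
def p : Par := Par.letter Color.pole

/-- The word consisting of one strand. -/
def s : Par := Par.letter Color.strand

/-- The positive crossing of a pole and a strand (the pole passes over the strand). -/
noncomputable def sigmaPos : p * s ⟶ s * p :=
  ofBraid (gen 0) (isMixedBraid_gen (by simp)) rfl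

/-- The negative crossing of a pole and a strand (the pole passes under the strand). -/
noncomputable def sigmaNeg : p * s ⟶ s * p :=
  ofBraid (gen 0)⁻¹ (isMixedBraid_gen (by simp)).inv rfl

/-- The associativity morphism `(pp)s ⟶ p(ps)`, with trivial underlying braid. -/
noncomputable def alphaPPS : (p * p) * s ⟶ p * (p * s) :=
  ofBraid 1 (.one _) rfl

/-- The associativity morphism `(ps)p ⟶ p(sp)`, with trivial underlying braid. -/
noncomputable def alphaPSP : (p * s) * p ⟶ p * (s * p) :=
  ofBraid 1 (.one _) rfl

/-- The associativity morphism `(sp)p ⟶ s(pp)`, with trivial underlying braid. -/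
noncomputable def alphaSPP : (s * p) * p ⟶ s * (p * p) :=
  ofBraid 1 (.one _) rfl

/-- The five basic morphisms. -/
inductive IsBasic : ∀ {O O' : Par}, (O ⟶ O') → Prop
  | sigmaPos : IsBasic sigmaPos
  | sigmaNeg : IsBasic sigmaNeg
  | alphaPPS : IsBasic alphaPPS
  | alphaPSP : IsBasic alphaPSP
  | alphaSPP : IsBasic alphaSPP

/-- The basic morphisms, their inverses, and the images of these under repeated applications of the
operadic operations. -/
inductive IsElementary : ∀ {O O' : Par}, (O ⟶ O') → Prop
  | basic {O O' : Par} (f : O ⟶ O') : IsBasic f → IsElementary f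
  | inverse {O O' : Par} (e : O ≅ O') : IsBasic e.hom → IsElementary e.inv
  | extendLeft (c : Color) {O O' : Par} (f : O ⟶ O') :
      IsElementary f → IsElementary (extendLeft c f)
  | extendRight (c : Color) {O O' : Par} (f : O ⟶ O') :
      IsElementary f → IsElementary (extendRight c f)
  | cabling {O O' : Par} (f : O ⟶ O') (i : ℕ) (hi : i < O.word.length) :
      IsElementary f → IsElementary (cabling f i hi)
  | poleToStrand {O O' : Par} (f : O ⟶ O') (i : ℕ) (hi : colorAt O.word i = Color.pole) :
      IsElementary f → IsElementary (poleToStrand f i)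

/-- Finite (possibly empty) compositions of elementary morphisms. -/
inductive IsProduct : ∀ {O O' : Par}, (O ⟶ O') → Prop
  | id (O : Par) : IsProduct (𝟙 O)
  | comp {O O' O'' : Par} (f : O ⟶ O') (g : O' ⟶ O'') :
      IsElementary f → IsProduct g → IsProduct (f ≫ g)

/-- The morphism `f = (∑ cⱼ βⱼ, σ)` belongs to the `ℚ`-linear category generated by the elementary
morphisms: its first entry is a `ℚ`-linear combination of (first entries of) compositions of
elementary morphisms with the same source, target and underlying permutation `σ`. -/
def IsGenerated {O O' : Par} (f : O ⟶ O') : Prop :=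
  f.comb ∈ Submodule.span ℚ
    {x | ∃ g : O ⟶ O', IsProduct g ∧ g.perm = f.perm ∧ g.comb = x}

end PaMB

end MixedBraids

/-!
Without the parentheses the proposition says that a mixed braid is a product of crossings of
neighbouring letters that are not both poles. Such crossings sort every word into `m` poles
followed by `n` strands. The loops of a pole around a strand and the crossings of the strands
generate a subgroup of braids of this sorted word that is normalized by the braids of the poles.
Hence every braid that respects the colors is the product of an element of this subgroup and a braid
of the poles, and for a mixed braid the latter is trivial, as forgetting the strands shows.

Doubling turns an added straight letter into any parenthesized word. So a crossing, or an associator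
with a factor that has no poles, is available inside any parenthesized word, and a letter can be
brought into a pair with a neighbouring strand. This reduces coherence (parenthesizations of the
same word with the same skeleton are connected by associators) to words with one letter fewer: pair
a letter with a neighbouring strand on both sides, shrink each pair to one letter, and double that
letter again in the resulting chain of associators.
-/

namespace MixedBraids

section LabelledPath

/-- The paths in the graph with edges `R`, labelled by the product of the labels of their edges. -/
inductive LabelledPath {α M : Type*} [Monoid M] (R : α → α → M → Prop) : α → α → M → Prop
  | one (a : α) : LabelledPath R a a 1
  | of {a b : α} {x : M} : R a b x → LabelledPath R a b x
  | mul {a b c : α} {x y : M} :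
      LabelledPath R a b x → LabelledPath R b c y → LabelledPath R a c (x * y)

variable {α α' M M' : Type*}

theorem LabelledPath.map [Monoid M] [Monoid M'] {R : α → α → M → Prop} {R' : α' → α' → M' → Prop}
    {a b : α} {x : M} (h : LabelledPath R a b x) (f : α → α') (φ : M →* M')
    (hR : ∀ a b x, R a b x → R' (f a) (f b) (φ x)) : LabelledPath R' (f a) (f b) (φ x) := by
  induction h with
  | one a => simpa only [map_one] using one (f a)
  | of h => exact .of (hR _ _ _ h)
  | mul _ _ ih ih' => simpa only [map_mul] using ih.mul ih'

theorem LabelledPath.inv [Group M] {R : α → α → M → Prop} {a b : α} {x : M}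
    (h : LabelledPath R a b x) (hR : ∀ a b x, R a b x → R b a x⁻¹) : LabelledPath R b a x⁻¹ := by
  induction h with
  | one a => simpa only [inv_one] using one a
  | of h => exact .of (hR _ _ _ h)
  | mul _ _ ih ih' => simpa only [mul_inv_rev] using ih'.mul ih

end LabelledPath

section LocalBraid

/-- A crossing of two neighbouring letters that are not both poles. -/
inductive LocalCrossing : List Color → List Color → BraidInf → Prop
  | pos (u v : List Color) {a b : Color} (h : ¬ (a = Color.pole ∧ b = Color.pole)) :
      LocalCrossing (u ++ a :: b :: v) (u ++ b :: a :: v) (gen u.length)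
  | neg (u v : List Color) {a b : Color} (h : ¬ (a = Color.pole ∧ b = Color.pole)) :
      LocalCrossing (u ++ a :: b :: v) (u ++ b :: a :: v) (gen u.length)⁻¹

/-- The products of crossings of neighbours that are not both poles. Proposition 4.1 for braids
between words, without the parentheses, says that every mixed braid is one. -/
abbrev LocalBraid : List Color → List Color → BraidInf → Prop := LabelledPath LocalCrossing

variable {o o' : List Color} {β : BraidInf}

theorem LocalCrossing.inv (h : LocalCrossing o o' β) : LocalCrossing o' o β⁻¹ := by
  cases h with
  | pos u v h => exact .neg u v fun h' => h h'.symm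
  | neg u v h => rw [inv_inv]; exact .pos u v fun h' => h h'.symm

theorem LocalCrossing.cons (h : LocalCrossing o o' β) (c : Color) :
    LocalCrossing (c :: o) (c :: o') (shift β) := by
  cases h with
  | pos u v h => simpa using pos (c :: u) v h
  | neg u v h => simpa using neg (c :: u) v h

theorem isMixedBraid_gen_append (u v : List Color) {a b : Color}
    (h : ¬ (a = Color.pole ∧ b = Color.pole)) :
    IsMixedBraid (u ++ a :: b :: v) (u ++ b :: a :: v) (gen u.length) := by
  induction u with
  | nil =>
    induction v using List.reverseRecOn with
    | nil => exact PaMB.isMixedBraid_gen h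
    | append_singleton v c ih => simpa using ih.append c
  | cons c u ih => simpa using ih.cons c

theorem LocalCrossing.isMixedBraid (h : LocalCrossing o o' β) : IsMixedBraid o o' β := by
  cases h with
  | pos u v h => exact isMixedBraid_gen_append u v h
  | neg u v h => exact (isMixedBraid_gen_append u v fun h' => h h'.symm).inv

theorem LocalBraid.inv (h : LocalBraid o o' β) : LocalBraid o' o β⁻¹ :=
  LabelledPath.inv h fun _ _ _ => LocalCrossing.inv

theorem LocalBraid.cons (h : LocalBraid o o' β) (c : Color) :
    LocalBraid (c :: o) (c :: o') (shift β) :=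
  LabelledPath.map h (c :: ·) shift fun _ _ _ h => h.cons c

theorem LocalBraid.isMixedBraid (h : LocalBraid o o' β) : IsMixedBraid o o' β := by
  induction h with
  | one => exact .one _
  | of h => exact h.isMixedBraid
  | mul _ _ ih ih' => exact ih.mul ih'

end LocalBraid

section BraidRelation

variable {G : Type*} [Group G] {a b : G}

theorem conj_sq_of_braid (h : a * b * a = b * a * b) : a * (b * b) * a⁻¹ = b⁻¹ * (a * a) * b := by
  have hab : a * b * a⁻¹ = b⁻¹ * a * b := by
    rw [mul_inv_eq_iff_eq_mul, mul_assoc, mul_assoc, eq_inv_mul_iff_mul_eq, ← mul_assoc,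
      ← mul_assoc, h]
  calc a * (b * b) * a⁻¹ = (a * b * a⁻¹) * (a * b * a⁻¹) := by group
    _ = b⁻¹ * (a * a) * b := by rw [hab]; group

theorem commute_of_braid (h : a * b * a = b * a * b) : Commute a (b * (a * a) * b) :=
  calc a * (b * (a * a) * b) = (a * b * a) * (a * b) := by group
    _ = b * a * (b * a * b) := by rw [h]; group
    _ = b * (a * a) * b * a := by rw [← h]; group

theorem conj_mem_of_commute {H : Subgroup G} {x y : G} (hxy : a * x * a⁻¹ = y)
    (hc : Commute a (x * y)) (hx : x ∈ H) (hy : y ∈ H) :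
    (a * x * a⁻¹ ∈ H ∧ a⁻¹ * x * a ∈ H) ∧ (a * y * a⁻¹ ∈ H ∧ a⁻¹ * y * a ∈ H) := by
  have hyx : a⁻¹ * y * a = x := by rw [← hxy]; group
  have hx' : a⁻¹ * x * a = x * y * x⁻¹ :=
    calc a⁻¹ * x * a = a⁻¹ * (x * y * a) * (a⁻¹ * y * a)⁻¹ := by group
      _ = x * y * x⁻¹ := by rw [← hc.eq, hyx]; group
  have hy' : a * y * a⁻¹ = y⁻¹ * x * y :=
    calc a * y * a⁻¹ = (a * x * a⁻¹)⁻¹ * (a * (x * y)) * a⁻¹ := by group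
      _ = y⁻¹ * x * y := by rw [hc.eq, hxy]; group
  rw [hxy, hx', hy', hyx]
  exact ⟨⟨hy, mul_mem (mul_mem hx hy) (inv_mem hx)⟩, mul_mem (mul_mem (inv_mem hy) hx) hy, hx⟩

theorem mem_normalizer_closure {S : Set G} {g : G}
    (h : ∀ x ∈ S, g * x * g⁻¹ ∈ Subgroup.closure S ∧ g⁻¹ * x * g ∈ Subgroup.closure S) :
    g ∈ Subgroup.normalizer (Subgroup.closure S : Set G) := by
  have conj (g : G) (h : ∀ x ∈ S, g * x * g⁻¹ ∈ Subgroup.closure S) :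
      Subgroup.closure S ≤ (Subgroup.closure S).comap (MulAut.conj g).toMonoidHom :=
    (Subgroup.closure_le _).2 h
  refine Subgroup.mem_normalizer_iff.2 fun x =>
    ⟨fun hx => conj g (fun x hx => (h x hx).1) hx, fun hx => ?_⟩
  have := conj g⁻¹ (fun x hx => by simpa using (h x hx).2) hx
  simpa [mul_assoc] using this

end BraidRelation

section Sweep

theorem gen_zero_commute (β : BraidInf) : Commute (gen 0) (shift (shift β)) := by
  induction β using braid_induction with
  | one => simp
  | gen' k => rw [shift_gen, shift_gen]; exact gen_comm (by omega)
  | mul β γ hβ hγ => simpa using hβ.mul_right hγ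
  | inv β hβ => simpa using hβ.inv_right

/-- The braid moving the leftmost strand to the right across the `m` strands next to it, which all
go on the same side of it. -/
def sweep : ℕ → BraidInf
  | 0 => 1
  | m + 1 => gen 0 * shift (sweep m)

theorem gen_succ_mul_sweep {i m : ℕ} (h : i + 1 < m) :
    gen (i + 1) * sweep m = sweep m * gen i := by
  induction m generalizing i with
  | zero => omega
  | succ m ih =>
    cases i with
    | zero =>
      obtain ⟨m, rfl⟩ : ∃ k, m = k + 1 := ⟨m - 1, by omega⟩
      simp only [sweep, map_mul, shift_gen]
      calc gen 1 * (gen 0 * (gen 1 * shift (shift (sweep m))))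
          = gen 1 * gen 0 * gen 1 * shift (shift (sweep m)) := by group
        _ = gen 0 * gen 1 * (gen 0 * shift (shift (sweep m))) := by rw [← gen_braid 0]; group
        _ = gen 0 * (gen 1 * shift (shift (sweep m))) * gen 0 := by
          rw [(gen_zero_commute _).eq]; group
    | succ i =>
      calc gen (i + 2) * (gen 0 * shift (sweep m))
          = gen 0 * shift (gen (i + 1) * sweep m) := by
            rw [map_mul, shift_gen, ← mul_assoc, ← mul_assoc, gen_comm (by omega : 0 + 2 ≤ i + 2)]
        _ = gen 0 * shift (sweep m) * gen (i + 1) := by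
            rw [ih (by omega), map_mul, shift_gen, mul_assoc]

theorem gen_zero_mul_sweep_sweep (m : ℕ) :
    gen 0 * (shift (sweep m) * sweep m) = shift (sweep m) * sweep m * gen m := by
  induction m with
  | zero => simp [sweep]
  | succ m ih =>
    have hc :
        gen 1 * shift (shift (sweep m)) * gen 0 = gen 1 * gen 0 * shift (shift (sweep m)) := by
      rw [mul_assoc, ← (gen_zero_commute _).eq, mul_assoc]
    have ih' := congrArg shift ih
    simp only [map_mul, shift_gen, zero_add] at ih'
    simp only [sweep, map_mul, shift_gen, zero_add]
    calc gen 0 * (gen 1 * shift (shift (sweep m)) * (gen 0 * shift (sweep m)))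
        = gen 0 * (gen 1 * shift (shift (sweep m)) * gen 0 * shift (sweep m)) := by group
      _ = gen 0 * gen 1 * gen 0 * (shift (shift (sweep m)) * shift (sweep m)) := by rw [hc]; group
      _ = gen 1 * gen 0 * (gen 1 * (shift (shift (sweep m)) * shift (sweep m))) := by
        rw [gen_braid 0]; group
      _ = gen 1 * gen 0 * shift (shift (sweep m)) * shift (sweep m) * gen (m + 1) := by
        rw [ih']; group
      _ = _ := by rw [← hc]; group

theorem localBraid_sweep (m : ℕ) (v : List Color) :
    LocalBraid (Color.strand :: (List.replicate m Color.pole ++ v))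
      (List.replicate m Color.pole ++ Color.strand :: v) (sweep m) := by
  induction m with
  | zero => exact .one _
  | succ m ih =>
    exact .mul (.of (.pos [] (List.replicate m Color.pole ++ v) (by simp)))
      (ih.cons Color.pole)

end Sweep

section PureGenerators

/-- The loop of the first of `m + 1` poles around the strand to the right of the last one; it
crosses the strand twice, in front of or behind the poles in between. -/
def loop (m : ℕ) : BraidInf := (shift (sweep m))⁻¹ * (gen 0 * gen 0) * shift (sweep m)

/-- Generators of a group of local braids on `m` poles followed by `n` strands. -/
inductive LocalGen : ℕ → ℕ → BraidInf → Prop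
  | ofStrands {k n : ℕ} (h : k + 1 < n) : LocalGen 0 n (gen k)
  | ofLoop (m n : ℕ) : LocalGen (m + 1) (n + 1) (loop m)
  | ofShift {m n : ℕ} {β : BraidInf} : LocalGen m n β → LocalGen (m + 1) n (shift β)

/-- A group of local braids on `m` poles followed by `n` strands. It is normalized by the braids
of the poles, and together these generate the braids that respect the colors. -/
def localSubgroup (m n : ℕ) : Subgroup BraidInf := Subgroup.closure {β | LocalGen m n β}

theorem LocalGen.mem {m n : ℕ} {β : BraidInf} (h : LocalGen m n β) : β ∈ localSubgroup m n :=
  Subgroup.subset_closure h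

theorem localGen_gen {k n : ℕ} (h : k + 1 < n) (m : ℕ) : LocalGen m n (gen (m + k)) := by
  induction m with
  | zero => simpa using LocalGen.ofStrands h
  | succ m ih => simpa only [shift_gen, Nat.add_right_comm] using ih.ofShift

theorem shift_mem_localSubgroup {m n : ℕ} {β : BraidInf} (hβ : β ∈ localSubgroup m n) :
    shift β ∈ localSubgroup (m + 1) n := by
  have : localSubgroup m n ≤ (localSubgroup (m + 1) n).comap shift :=
    (Subgroup.closure_le _).2 fun _ h => h.ofShift.mem
  exact this hβ

theorem sweep_conj_shift_loop (m : ℕ) :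
    (sweep (m + 1))⁻¹ * shift (loop m) * sweep (m + 1) =
      gen (m + 1) * loop m * (gen (m + 1))⁻¹ := by
  have hX := congrArg shift (gen_zero_mul_sweep_sweep m)
  simp only [map_mul, shift_gen, zero_add] at hX
  have hc := gen_zero_commute (sweep m)
  simp only [loop, sweep, map_mul, map_inv, shift_gen, zero_add]
  generalize shift (shift (sweep m)) = U at *
  generalize shift (sweep m) = T at *
  have hX' : (gen 1)⁻¹ * (U * T) = U * T * (gen (m + 1))⁻¹ := by
    rw [inv_mul_eq_iff_eq_mul, ← mul_assoc, hX, mul_inv_cancel_right]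
  have hX'' : (U * T)⁻¹ * gen 1 = gen (m + 1) * (U * T)⁻¹ := by
    rw [inv_mul_eq_iff_eq_mul, ← mul_assoc, ← hX, mul_inv_cancel_right]
  calc (gen 0 * T)⁻¹ * (U⁻¹ * (gen 1 * gen 1) * U) * (gen 0 * T)
      = T⁻¹ * ((gen 0)⁻¹ * U⁻¹ * (gen 1 * gen 1) * (U * gen 0)) * T := by group
    _ = (U * T)⁻¹ * ((gen 0)⁻¹ * (gen 1 * gen 1) * gen 0) * (U * T) := by
      rw [← hc.eq, hc.inv_inv.eq]; group
    _ = (U * T)⁻¹ * gen 1 * (gen 0 * gen 0) * ((gen 1)⁻¹ * (U * T)) := by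
      have := conj_sq_of_braid (gen_braid 0).symm
      rw [zero_add] at this
      rw [← this]; group
    _ = gen (m + 1) * T⁻¹ * (U⁻¹ * (gen 0 * gen 0) * U) * T * (gen (m + 1))⁻¹ := by
      rw [hX', hX'']; group
    _ = _ := by
      rw [mul_assoc U⁻¹, (hc.mul_left hc).eq, inv_mul_cancel_left]; group

theorem LocalGen.sweep_conj_mem {m n : ℕ} {β : BraidInf} (h : LocalGen m n β) :
    (sweep m)⁻¹ * shift β * sweep m ∈ localSubgroup m (n + 1) := by
  induction h with
  | ofStrands h => simpa [sweep] using (LocalGen.ofStrands (Nat.succ_lt_succ h)).mem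
  | ofLoop m n =>
    have hg := (localGen_gen (k := 0) (n := n + 1 + 1) (by omega) (m + 1)).mem
    rw [sweep_conj_shift_loop]
    exact mul_mem (mul_mem hg (LocalGen.ofLoop m (n + 1)).mem) (inv_mem hg)
  | @ofShift m n β _ ih =>
    have : (sweep (m + 1))⁻¹ * shift (shift β) * sweep (m + 1) =
        shift ((sweep m)⁻¹ * shift β * sweep m) := by
      simp only [sweep, map_mul, map_inv]
      rw [mul_inv_rev, mul_assoc _ (gen 0)⁻¹, (gen_zero_commute β).inv_left.eq]
      group
    rw [this]
    exact shift_mem_localSubgroup ih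

theorem sweep_conj_mem_localSubgroup {m n : ℕ} {β : BraidInf} (hβ : β ∈ localSubgroup m n) :
    (sweep m)⁻¹ * shift β * sweep m ∈ localSubgroup m (n + 1) := by
  have : localSubgroup m n ≤ (localSubgroup m (n + 1)).comap
      ((MulAut.conj (sweep m)⁻¹).toMonoidHom.comp shift) :=
    (Subgroup.closure_le _).2 fun _ h => by simpa using h.sweep_conj_mem
  simpa using this hβ

theorem commute_gen_loop {i m : ℕ} (h : i + 1 < m) : Commute (gen (i + 1)) (loop m) := by
  have hT : SemiconjBy (shift (sweep m)) (gen (i + 1)) (gen (i + 2)) := by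
    have := congrArg shift (gen_succ_mul_sweep h)
    simp only [map_mul, shift_gen] at this
    exact this.symm
  have h0 : Commute (gen (i + 2)) (gen 0) := (gen_comm (by omega)).symm
  have hT' : SemiconjBy (shift (sweep m))⁻¹ (gen (i + 2)) (gen (i + 1)) := hT.inv_symm_left
  exact ((hT'.mul_left (h0.mul_right h0).symm).mul_left hT).symm

theorem conj_shift_loop (m : ℕ) : gen 0 * shift (loop m) * (gen 0)⁻¹ = loop (m + 1) := by
  have hc := gen_zero_commute (sweep m)
  simp only [loop, sweep, map_mul, map_inv, shift_gen, zero_add]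
  generalize shift (shift (sweep m)) = U at *
  calc gen 0 * (U⁻¹ * (gen 1 * gen 1) * U) * (gen 0)⁻¹
      = gen 0 * U⁻¹ * (gen 1 * gen 1) * (U * (gen 0)⁻¹) := by group
    _ = U⁻¹ * (gen 0 * (gen 1 * gen 1) * (gen 0)⁻¹) * U := by
      rw [hc.inv_right.eq, ← hc.inv_left.eq]; group
    _ = (gen 1 * U)⁻¹ * (gen 0 * gen 0) * (gen 1 * U) := by
      rw [conj_sq_of_braid (gen_braid 0)]; group

theorem commute_gen_zero_loops (m : ℕ) : Commute (gen 0) (shift (loop m) * loop (m + 1)) := by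
  have hc := gen_zero_commute (sweep m)
  have : shift (loop m) * loop (m + 1) = (shift (shift (sweep m)))⁻¹ *
      (gen 1 * (gen 0 * gen 0) * gen 1) * shift (shift (sweep m)) := by
    simp only [loop, sweep, map_mul, map_inv, shift_gen, zero_add]
    group
  rw [this]
  exact (hc.inv_right.mul_right (commute_of_braid (gen_braid 0))).mul_right hc

theorem LocalGen.conj_gen_mem {m n i : ℕ} {β : BraidInf} (h : LocalGen m n β) (hi : i + 1 < m) :
    gen i * β * (gen i)⁻¹ ∈ localSubgroup m n ∧ (gen i)⁻¹ * β * gen i ∈ localSubgroup m n := by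
  have of_commute {m n i : ℕ} {β : BraidInf} (h : LocalGen m n β) (hc : Commute (gen i) β) :
      gen i * β * (gen i)⁻¹ ∈ localSubgroup m n ∧ (gen i)⁻¹ * β * gen i ∈ localSubgroup m n := by
    rw [hc.eq, mul_inv_cancel_right, mul_assoc, ← hc.eq, inv_mul_cancel_left]
    exact ⟨h.mem, h.mem⟩
  induction h generalizing i with
  | ofStrands => omega
  | ofLoop m n =>
    cases i with
    | zero =>
      obtain ⟨m, rfl⟩ : ∃ k, m = k + 1 := ⟨m - 1, by omega⟩
      exact (conj_mem_of_commute (conj_shift_loop m) (commute_gen_zero_loops m)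
        (LocalGen.ofLoop m n).ofShift.mem (LocalGen.ofLoop (m + 1) n).mem).2
    | succ i => exact of_commute (.ofLoop m n) (commute_gen_loop (by omega))
  | @ofShift m n β h ih =>
    cases i with
    | zero =>
      cases h with
      | ofStrands => omega
      | ofLoop m n =>
        exact (conj_mem_of_commute (conj_shift_loop m) (commute_gen_zero_loops m)
          (LocalGen.ofLoop m n).ofShift.mem (LocalGen.ofLoop (m + 1) n).mem).1
      | @ofShift m n β h => exact of_commute h.ofShift.ofShift (gen_zero_commute β)
    | succ i =>
      have := ih (Nat.lt_of_succ_lt_succ hi)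
      simpa using this.imp shift_mem_localSubgroup shift_mem_localSubgroup

theorem braidSubgroup_le_normalizer (m n : ℕ) :
    braidSubgroup m ≤ Subgroup.normalizer (localSubgroup m n : Set BraidInf) := by
  refine (Subgroup.closure_le _).2 ?_
  rintro _ ⟨i, hi, rfl⟩
  exact mem_normalizer_closure fun β h => h.conj_gen_mem hi

end PureGenerators

section Sorting

/-- The word of `m` poles followed by `n` strands. -/
def sortedWord (m n : ℕ) : List Color :=
  List.replicate m Color.pole ++ List.replicate n Color.strand

theorem LocalGen.localBraid {m n : ℕ} {β : BraidInf} (h : LocalGen m n β) :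
    LocalBraid (sortedWord m n) (sortedWord m n) β := by
  induction h with
  | @ofStrands k n h =>
    obtain ⟨d, rfl⟩ : ∃ d, n = k + (d + 2) := ⟨n - k - 2, by omega⟩
    have := LocalCrossing.pos (List.replicate k Color.strand) (List.replicate d Color.strand)
      (a := Color.strand) (b := Color.strand) (by simp)
    simp only [← List.replicate_succ, List.replicate_append_replicate,
      List.length_replicate] at this
    exact .of this
  | ofLoop m n =>
    have hs := (localBraid_sweep m (List.replicate n Color.strand)).cons Color.pole
    have hg : LocalBraid (Color.pole :: Color.strand :: sortedWord m n)
        (Color.pole :: Color.strand :: sortedWord m n) (gen 0 * gen 0) :=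
      .mul (.of (.pos [] (sortedWord m n) (by simp))) (.of (.pos [] (sortedWord m n) (by simp)))
    exact .mul (.mul hs.inv hg) hs
  | ofShift _ ih => exact ih.cons Color.pole

theorem localBraid_of_mem {m n : ℕ} {β : BraidInf} (h : β ∈ localSubgroup m n) :
    LocalBraid (sortedWord m n) (sortedWord m n) β := by
  induction h using Subgroup.closure_induction with
  | mem _ h => exact h.localBraid
  | one => exact .one _
  | mul _ _ _ _ ih ih' => exact .mul ih ih'
  | inv _ _ ih => exact ih.inv

/-- A local braid that moves the poles of a word to the left. -/
def sorting : List Color → BraidInf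
  | [] => 1
  | Color.pole :: o => shift (sorting o)
  | Color.strand :: o => shift (sorting o) * sweep (o.count Color.pole)

theorem localBraid_sorting (o : List Color) :
    LocalBraid o (sortedWord (o.count Color.pole) (o.count Color.strand)) (sorting o) := by
  induction o with
  | nil => exact .one _
  | cons c o ih =>
    cases c with
    | pole => simpa [sorting, sortedWord, List.replicate_succ] using ih.cons Color.pole
    | strand =>
      have := localBraid_sweep (o.count Color.pole)
        (List.replicate (o.count Color.strand) Color.strand)
      simpa [sorting, sortedWord, List.replicate_succ] using (ih.cons Color.strand).mul this

/-- The braids of `m` poles and `n` strands that are generated by `localSubgroup m n` and the braids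
of the poles. -/
def coloredBraids (m n : ℕ) : Subgroup BraidInf := localSubgroup m n ⊔ braidSubgroup m

theorem localSubgroup_le_coloredBraids (m n : ℕ) : localSubgroup m n ≤ coloredBraids m n :=
  le_sup_left

theorem braidSubgroup_le_coloredBraids (m n : ℕ) : braidSubgroup m ≤ coloredBraids m n :=
  le_sup_right

theorem shift_mem_coloredBraids {m n : ℕ} {β : BraidInf} (h : β ∈ coloredBraids m n) :
    shift β ∈ coloredBraids (m + 1) n := by
  have : coloredBraids m n ≤ (coloredBraids (m + 1) n).comap shift :=
    sup_le (fun _ h => localSubgroup_le_coloredBraids _ _ (shift_mem_localSubgroup h))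
      fun _ h => braidSubgroup_le_coloredBraids _ _ (shift_mem h)
  exact this h

theorem sweep_conj_mem_coloredBraids {m n : ℕ} {β : BraidInf} (h : β ∈ coloredBraids m n) :
    (sweep m)⁻¹ * shift β * sweep m ∈ coloredBraids m (n + 1) := by
  have : coloredBraids m n ≤ (coloredBraids m (n + 1)).comap
      ((MulAut.conj (sweep m)⁻¹).toMonoidHom.comp shift) := by
    refine sup_le (fun β h => ?_) ((Subgroup.closure_le _).2 ?_)
    · simpa using localSubgroup_le_coloredBraids _ _ (sweep_conj_mem_localSubgroup h)
    · rintro _ ⟨i, hi, rfl⟩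
      have : (sweep m)⁻¹ * gen (i + 1) * sweep m = gen i := by
        rw [mul_assoc, gen_succ_mul_sweep hi, inv_mul_cancel_left]
      simpa [this] using braidSubgroup_le_coloredBraids m (n + 1) (gen_mem hi)
  simpa using this h

theorem sorting_conj_gen_zero_mem (v : List Color) (a b : Color) :
    (sorting (a :: b :: v))⁻¹ * gen 0 * sorting (b :: a :: v) ∈
      coloredBraids ((a :: b :: v).count Color.pole) ((a :: b :: v).count Color.strand) := by
  have hc := gen_zero_commute (sorting v)
  set m := v.count Color.pole with hm
  set n := v.count Color.strand with hn
  cases a <;> cases b <;>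
    simp only [sorting, map_mul, List.count_cons, ← hm, ← hn, beq_iff_eq, reduceCtorEq, if_true,
      if_false, add_zero, sweep]
  · rw [mul_assoc, hc.eq, inv_mul_cancel_left]
    exact braidSubgroup_le_coloredBraids _ _ (gen_mem (by omega))
  · convert localSubgroup_le_coloredBraids _ _ (LocalGen.ofLoop m n).mem using 1
    simp only [loop, mul_inv_rev, mul_assoc]
    rw [hc.left_comm, inv_mul_cancel_left]
  · convert one_mem (coloredBraids (m + 1) (n + 1)) using 1
    simp only [mul_inv_rev, mul_assoc]
    rw [hc.left_comm, inv_mul_cancel_left, inv_mul_cancel_left, inv_mul_cancel]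
  · have hX := gen_zero_mul_sweep_sweep m
    convert localSubgroup_le_coloredBraids _ _ (localGen_gen (k := 0) (n := n + 2) (by omega) m).mem
      using 1
    simp only [mul_inv_rev, mul_assoc, add_zero] at hX ⊢
    rw [hc.left_comm, inv_mul_cancel_left, hX, inv_mul_cancel_left, inv_mul_cancel_left]

theorem sorting_conj_gen_mem (u v : List Color) (a b : Color) :
    (sorting (u ++ a :: b :: v))⁻¹ * gen u.length * sorting (u ++ b :: a :: v) ∈
      coloredBraids ((u ++ a :: b :: v).count Color.pole)
        ((u ++ a :: b :: v).count Color.strand) := by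
  induction u with
  | nil => exact sorting_conj_gen_zero_mem v a b
  | cons c u ih =>
    have hcount : (u ++ b :: a :: v).count Color.pole = (u ++ a :: b :: v).count Color.pole :=
      ((List.Perm.swap a b v).append_left u).count_eq Color.pole
    cases c with
    | pole => simpa [sorting] using shift_mem_coloredBraids ih
    | strand => simpa [sorting, hcount, mul_assoc] using sweep_conj_mem_coloredBraids ih

end Sorting

section Colors

theorem colorAt_swap (u : List Color) (a b : Color) (v : List Color) (i : ℕ) :
    colorAt (u ++ b :: a :: v) (Equiv.swap u.length (u.length + 1) i) =
      colorAt (u ++ a :: b :: v) i := by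
  simp only [colorAt, Equiv.swap_apply_def]
  split_ifs with h1 h2
  · subst h1; simp
  · subst h2; simp
  · rcases lt_or_ge i u.length with h | h
    · simp [List.getElem?_append_left h]
    · obtain ⟨d, rfl⟩ : ∃ d, i = u.length + (d + 2) := ⟨i - u.length - 2, by omega⟩
      simp [List.getElem?_append_right]

theorem eq_of_colorAt_eq {o o' : List Color} (hl : o'.length = o.length)
    (h : ∀ i, colorAt o' i = colorAt o i) : o' = o := by
  refine List.ext_getElem hl fun i h1 h2 => ?_
  simpa [colorAt, h1, h2] using h i

theorem exists_eq_append_pair {α : Type*} {o : List α} {k : ℕ} (h : k + 1 < o.length) :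
    ∃ u a b v, o = u ++ a :: b :: v ∧ u.length = k := by
  refine ⟨o.take k, o[k], o[k + 1], o.drop (k + 2), ?_, by simp; omega⟩
  rw [← List.drop_eq_getElem_cons, ← List.drop_eq_getElem_cons, List.take_append_drop]

theorem forget_all_poles (β : BraidInf) : forget (fun _ => Color.pole) β = β := by
  have hcomp (β : BraidInf) : (fun _ : ℕ => Color.pole) ∘ footHom β = fun _ => Color.pole := rfl
  induction β using braid_induction with
  | one => exact forget_one _
  | gen' k => simp [forget_gen, forgetVal, polesBelow_all]
  | mul β γ hβ hγ => rw [forget_mul, hcomp, hβ, hγ]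
  | inv β hβ => rw [forget_inv, hcomp, hβ]

theorem exists_sorting_conj_mem {l : ℕ} {β : BraidInf} (hβ : β ∈ braidSubgroup l)
    {o : List Color} (ho : o.length = l) :
    ∃ o' : List Color, o'.Perm o ∧ (∀ i, colorAt o' (strandPerm β i) = colorAt o i) ∧
      (sorting o)⁻¹ * β * sorting o' ∈
        coloredBraids (o.count Color.pole) (o.count Color.strand) := by
  induction hβ using Subgroup.closure_induction'' generalizing o with
  | mem _ h =>
    obtain ⟨k, hk, rfl⟩ := h
    obtain ⟨u, a, b, v, rfl, rfl⟩ := exists_eq_append_pair (hk.trans_eq ho.symm)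
    exact ⟨u ++ b :: a :: v, (List.Perm.swap a b v).append_left u,
      fun i => by rw [strandPerm_gen, colorAt_swap], sorting_conj_gen_mem u v a b⟩
  | inv_mem _ h =>
    obtain ⟨k, hk, rfl⟩ := h
    obtain ⟨u, a, b, v, rfl, rfl⟩ := exists_eq_append_pair (hk.trans_eq ho.symm)
    have hperm : (u ++ b :: a :: v).Perm (u ++ a :: b :: v) := (List.Perm.swap a b v).append_left u
    refine ⟨u ++ b :: a :: v, hperm,
      fun i => by rw [strandPerm_inv, strandPerm_gen, Equiv.swap_inv, colorAt_swap], ?_⟩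
    have := inv_mem (sorting_conj_gen_mem u v b a)
    rwa [hperm.count_eq, hperm.count_eq, mul_inv_rev, mul_inv_rev, inv_inv, ← mul_assoc] at this
  | one => exact ⟨o, .rfl, fun i => by simp [strandPerm], by simp [one_mem]⟩
  | mul β γ _ _ ihβ ihγ =>
    obtain ⟨o', hp, hc, hm⟩ := ihβ ho
    obtain ⟨o'', hp', hc', hm'⟩ := ihγ (hp.length_eq.trans ho)
    refine ⟨o'', hp'.trans hp, fun i => by
      rw [strandPerm_mul, Equiv.trans_apply, hc', hc], ?_⟩
    rw [hp.count_eq, hp.count_eq] at hm'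
    simpa [mul_assoc] using mul_mem hm hm'

theorem IsMixedBraid.sorting_conj_mem {o o' : List Color} {β : BraidInf}
    (h : IsMixedBraid o o' β) :
    o'.Perm o ∧ (sorting o)⁻¹ * β * sorting o' ∈
      coloredBraids (o.count Color.pole) (o.count Color.strand) := by
  obtain ⟨o'', hp, hc, hm⟩ := exists_sorting_conj_mem h.mem rfl
  obtain rfl : o'' = o' := eq_of_colorAt_eq (hp.length_eq.trans h.length_eq.symm) fun i => by
    rw [← (strandPerm β).apply_symm_apply i, hc, h.color]
  exact ⟨hp, hm⟩

theorem eq_one_of_isMixedBraid_sortedWord {m n : ℕ} {β : BraidInf} (hβ : β ∈ braidSubgroup m)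
    (h : IsMixedBraid (sortedWord m n) (sortedWord m n) β) : β = 1 := by
  have hpole (i : ℕ) (hi : i < m) : colorAt (sortedWord m n) i = Color.pole := by
    rw [sortedWord, colorAt_append_left (by simpa using hi)]
    simp [colorAt, hi]
  have := h.forget_eq
  rwa [forget_congr hβ hpole, forget_all_poles] at this

theorem IsMixedBraid.localBraid {o o' : List Color} {β : BraidInf} (h : IsMixedBraid o o' β) :
    LocalBraid o o' β := by
  obtain ⟨hperm, hmem⟩ := h.sorting_conj_mem
  set m := o.count Color.pole
  set n := o.count Color.strand
  have ho : LocalBraid o (sortedWord m n) (sorting o) := localBraid_sorting o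
  have ho' : LocalBraid o' (sortedWord m n) (sorting o') := by
    have := localBraid_sorting o'
    rwa [hperm.count_eq, hperm.count_eq] at this
  rw [coloredBraids, ← SetLike.mem_coe,
    Subgroup.coe_mul_of_right_le_normalizer_left _ _ (braidSubgroup_le_normalizer m n)] at hmem
  obtain ⟨γ, hγ, δ, hδ, heq : γ * δ = _⟩ := hmem
  have hγ := localBraid_of_mem hγ
  have hδ' : δ = 1 := by
    refine eq_one_of_isMixedBraid_sortedWord (n := n) hδ ?_
    rw [← inv_mul_cancel_left γ δ, heq]
    exact hγ.isMixedBraid.inv.mul ((ho.isMixedBraid.inv.mul h).mul ho'.isMixedBraid)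
  have hβ : β = sorting o * γ * (sorting o')⁻¹ := by
    rw [← mul_one γ, ← hδ', heq]; group
  rw [hβ]
  exact (ho.mul hγ).mul ho'.inv

end Colors

section Cabling

theorem cable_zero_shift (β : BraidInf) : cable 0 (shift β) = shift (shift β) := by
  have hfix (β : BraidInf) : strandPerm (shift β) 0 = 0 := by rw [strandPerm_shift, shiftPerm_zero]
  induction β using braid_induction with
  | one => simp [cable_one]
  | gen' k => simp [cable_gen, cableVal_lt]
  | mul β γ hβ hγ => rw [map_mul, cable_mul, hfix, hβ, hγ, map_mul]
  | inv β hβ => rw [map_inv, cable_inv, ← map_inv, hfix, hβ, map_inv, map_inv]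

theorem cable_succ_shift (i : ℕ) (β : BraidInf) : cable (i + 1) (shift β) = shift (cable i β) := by
  refine cocycle_ext (act := fun i β => strandPerm β i)
    (F := fun i β => cable (i + 1) (shift β)) (G := fun i β => shift (cable i β))
    ?_ ?_ ?_ ?_ ?_ i β
  · intro x β γ; simp [strandPerm_mul]
  · intro x; simp [strandPerm]
  · intro x β γ; simp [cable_mul, strandPerm_shift]
  · intro x β γ; simp [cable_mul]
  · intro i k
    simp only [shift_gen, cable_gen, cableVal]
    split_ifs <;> simp <;> omega

theorem cable_shift_iterate {j k : ℕ} (h : j < k) (β : BraidInf) :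
    cable j (shift^[k] β) = shift^[k + 1] β := by
  induction j generalizing k with
  | zero =>
    obtain ⟨k, rfl⟩ := Nat.exists_eq_succ_of_ne_zero h.ne'
    rw [Function.iterate_succ_apply', cable_zero_shift, Function.iterate_succ_apply',
      Function.iterate_succ_apply']
  | succ j ih =>
    obtain ⟨k, rfl⟩ := Nat.exists_eq_succ_of_ne_zero (Nat.ne_zero_of_lt h)
    rw [Function.iterate_succ_apply', cable_succ_shift, ih (Nat.lt_of_succ_lt_succ h),
      ← Function.iterate_succ_apply' shift]

theorem strandPerm_shift_iterate {j k : ℕ} (h : j < k) (β : BraidInf) :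
    strandPerm (shift^[k] β) j = j := by
  induction k generalizing j with
  | zero => exact absurd h j.not_lt_zero
  | succ k ih =>
    rw [Function.iterate_succ_apply', strandPerm_shift]
    cases j with
    | zero => exact shiftPerm_zero _
    | succ j => rw [shiftPerm_succ, ih (Nat.lt_of_succ_lt_succ h)]

theorem cable_of_le {l : ℕ} {β : BraidInf} (hβ : β ∈ braidSubgroup l) {i : ℕ} (hi : l ≤ i) :
    cable i β = β := by
  induction hβ using Subgroup.closure_induction with
  | mem x hx => obtain ⟨k, hk, rfl⟩ := hx; rw [cable_gen, cableVal_gt (by omega)]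
  | one => exact cable_one i
  | mul x y hx _ ihx ihy => rw [cable_mul, strandPerm_of_le hx hi, ihx, ihy]
  | inv x hx ih => rw [cable_inv, strandPerm_of_le (inv_mem hx) hi, ih]

end Cabling

open PaMB Par

section ElementaryBraid

variable {O O' : Par} {β : BraidInf}

/-- The isomorphism given by one mixed braid, with the inverse given by the inverse braid. -/
noncomputable def isoOfBraid (β : BraidInf) (h : IsMixedBraid O.word O'.word β)
    (hs : O.skeleton = O'.skeleton) : O ≅ O' where
  hom := ofBraid β h hs
  inv := ofBraid β⁻¹ h.inv hs.symm
  hom_inv_id := by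
    apply PaMBHom.ext
    · change (strandPerm β).trans (strandPerm β⁻¹) = Equiv.refl ℕ
      rw [strandPerm_inv]; exact Equiv.self_trans_symm _
    · change MonoidAlgebra.single β 1 * MonoidAlgebra.single β⁻¹ 1 = (1 : MonoidAlgebra ℚ BraidInf)
      simp [MonoidAlgebra.single_mul_single, MonoidAlgebra.one_def]
  inv_hom_id := by
    apply PaMBHom.ext
    · change (strandPerm β⁻¹).trans (strandPerm β) = Equiv.refl ℕ
      rw [strandPerm_inv]; exact Equiv.symm_trans_self _
    · change MonoidAlgebra.single β⁻¹ 1 * MonoidAlgebra.single β 1 = (1 : MonoidAlgebra ℚ BraidInf)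
      simp [MonoidAlgebra.single_mul_single, MonoidAlgebra.one_def]

/-- `β` is the braid of an elementary morphism from `O` to `O'` that is a parenthesized mixed
braid. -/
def IsElementaryBraid (O O' : Par) (β : BraidInf) : Prop :=
  ∃ h hs, IsElementary (ofBraid (O := O) (O' := O') β h hs)

namespace IsElementaryBraid

theorem isMixedBraid (he : IsElementaryBraid O O' β) : IsMixedBraid O.word O'.word β := he.choose

theorem left (he : IsElementaryBraid O O' β) (c : Color) :
    IsElementaryBraid (letter c * O) (letter c * O') (shift β) := by
  obtain ⟨h, hs, he⟩ := he
  have h' : IsMixedBraid (letter c * O).word (letter c * O').word (shift β) := by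
    rw [word_mul, word_mul]; exact h.cons c
  have heq : ofBraid (shift β) h' (PaMB.extendLeft c (ofBraid β h hs)).skeleton_eq =
      PaMB.extendLeft c (ofBraid β h hs) :=
    PaMBHom.ext (strandPerm_shift β) MonoidAlgebra.mapDomain_single.symm
  exact ⟨h', _, heq ▸ he.extendLeft c⟩

theorem right (he : IsElementaryBraid O O' β) (c : Color) :
    IsElementaryBraid (O * letter c) (O' * letter c) β := by
  obtain ⟨h, hs, he⟩ := he
  exact ⟨by rw [word_mul, word_mul]; exact h.append c, _, he.extendRight c⟩

theorem double (he : IsElementaryBraid O O' β) {i : ℕ} (hi : i < O.word.length) :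
    IsElementaryBraid (O.double i) (O'.double (strandPerm β i)) (cable i β) := by
  obtain ⟨h, hs, he⟩ := he
  have h' : IsMixedBraid (O.double i).word (O'.double (strandPerm β i)).word (cable i β) := by
    rw [Par.double, Par.double, word_replace, word_replace]; exact h.double hi
  have heq : ofBraid (cable i β) h' (PaMB.cabling (ofBraid β h hs) i hi).skeleton_eq =
      PaMB.cabling (ofBraid β h hs) i hi :=
    PaMBHom.ext (strandPerm_cable i β) MonoidAlgebra.mapDomain_single.symm
  exact ⟨h', _, heq ▸ he.cabling _ i hi⟩

theorem toStrand (he : IsElementaryBraid O O' β) {i : ℕ} (hi : colorAt O.word i = Color.pole) :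
    IsElementaryBraid (O.toStrand i) (O'.toStrand (strandPerm β i)) β := by
  obtain ⟨h, hs, he⟩ := he
  refine ⟨?_, (PaMB.poleToStrand (ofBraid β h hs) i).skeleton_eq, he.poleToStrand _ i hi⟩
  rw [Par.toStrand, Par.toStrand, word_replace, word_replace]
  exact h.toStrand i

end IsElementaryBraid

/-- `β` and `β⁻¹` are the braids of elementary morphisms from `O` to `O'` and back. -/
structure ElementaryIso (O O' : Par) (β : BraidInf) : Prop where
  hom : IsElementaryBraid O O' β
  inv : IsElementaryBraid O' O β⁻¹

namespace ElementaryIso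

theorem isMixedBraid (he : ElementaryIso O O' β) : IsMixedBraid O.word O'.word β :=
  he.hom.isMixedBraid

theorem skeleton_eq (he : ElementaryIso O O' β) : O.skeleton = O'.skeleton :=
  he.hom.choose_spec.choose

theorem of_isBasic {h : IsMixedBraid O.word O'.word β} {hs : O.skeleton = O'.skeleton}
    (hb : IsBasic (ofBraid β h hs)) : ElementaryIso O O' β where
  hom := ⟨h, hs, .basic _ hb⟩
  inv := ⟨h.inv, hs.symm, .inverse (isoOfBraid β h hs) hb⟩

theorem symm (he : ElementaryIso O O' β) : ElementaryIso O' O β⁻¹ where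
  hom := he.inv
  inv := by simpa only [inv_inv] using he.hom

theorem left (he : ElementaryIso O O' β) (c : Color) :
    ElementaryIso (letter c * O) (letter c * O') (shift β) where
  hom := he.hom.left c
  inv := by simpa only [map_inv] using he.inv.left c

theorem right (he : ElementaryIso O O' β) (c : Color) :
    ElementaryIso (O * letter c) (O' * letter c) β where
  hom := he.hom.right c
  inv := he.inv.right c

theorem double (he : ElementaryIso O O' β) {i : ℕ} (hi : i < O.word.length) :
    ElementaryIso (O.double i) (O'.double (strandPerm β i)) (cable i β) where
  hom := he.hom.double hi
  inv := by
    have hi' : strandPerm β i < O'.word.length :=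
      he.isMixedBraid.length_eq ▸ strandPerm_lt he.isMixedBraid.mem hi
    simpa [cable_inv, strandPerm_inv] using he.inv.double hi'

theorem toStrand (he : ElementaryIso O O' β) {i : ℕ} (hi : colorAt O.word i = Color.pole) :
    ElementaryIso (O.toStrand i) (O'.toStrand (strandPerm β i)) β where
  hom := he.hom.toStrand hi
  inv := by
    simpa [strandPerm_inv] using he.inv.toStrand ((he.isMixedBraid.color i).trans hi)

end ElementaryIso

end ElementaryBraid

section Context

/-- `f` is a parenthesized word with one hole, with the letters `u` to the left of the hole and the
letters `v` to the right of it. -/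
inductive IsContext : (Par → Par) → List Color → List Color → Prop
  | id : IsContext id [] []
  | mul_right {f : Par → Par} {u v : List Color} (B : Par) :
      IsContext f u v → IsContext (fun X => f X * B) u (v ++ B.word)
  | mul_left {f : Par → Par} {u v : List Color} (A : Par) :
      IsContext f u v → IsContext (fun X => A * f X) (A.word ++ u) v

theorem Par.replace_mul_left (F : Color → FreeMagma Color) {A : Par} (B : Par) {i : ℕ}
    (hi : i < A.word.length) : (A * B).replace F i = A.replace F i * B := by
  induction A using WithOne.recOneCoe with
  | one => exact absurd hi i.not_lt_zero
  | coe a =>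
    induction B using WithOne.recOneCoe with
    | one => rw [mul_one, mul_one]
    | coe b => exact congrArg WithOne.coe (if_pos hi)

theorem Par.replace_mul_right (F : Color → FreeMagma Color) (A B : Par) (i : ℕ) (hB : B ≠ 1) :
    (A * B).replace F (A.word.length + i) = A * B.replace F i := by
  obtain ⟨b, rfl⟩ := WithOne.ne_one_iff_exists.mp hB
  induction A using WithOne.recOneCoe with
  | one => rw [one_mul, one_mul]; exact congrArg _ (Nat.zero_add i)
  | coe a =>
    refine (congrArg WithOne.coe (if_neg (Nat.not_lt.mpr (Nat.le_add_right _ i)))).trans ?_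
    rw [Par.word, WithOne.recOneCoe_coe, Nat.add_sub_cancel_left]
    rfl

namespace IsContext

variable {f g : Par → Par} {u v w z : List Color}

theorem comp (hf : IsContext f u v) (hg : IsContext g w z) :
    IsContext (f ∘ g) (u ++ w) (z ++ v) := by
  induction hf with
  | id => simpa using hg
  | mul_right B _ ih => rw [← List.append_assoc]; exact ih.mul_right B
  | mul_left A _ ih => rw [List.append_assoc]; exact ih.mul_left A

theorem word_eq (hf : IsContext f u v) (X : Par) : (f X).word = u ++ X.word ++ v := by
  induction hf with
  | id => simp
  | mul_right B _ ih => simp [word_mul, ih]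
  | mul_left A _ ih => simp [word_mul, ih]

theorem skeleton_congr (hf : IsContext f u v) {X Y : Par} (h : X.skeleton = Y.skeleton) :
    (f X).skeleton = (f Y).skeleton := by
  induction hf with
  | id => exact h
  | mul_right B _ ih => rw [skeleton_mul, skeleton_mul, ih]
  | mul_left A _ ih => rw [skeleton_mul, skeleton_mul, ih]

theorem replace_letter (hf : IsContext f u v) (F : Color → FreeMagma Color) (c : Color) :
    (f (letter c)).replace F u.length = f (F c) := by
  induction hf with
  | id => rfl
  | @mul_right f u v B hf ih =>
    rw [replace_mul_left F B (by simp [hf.word_eq, word_letter]), ih]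
  | @mul_left f u v A hf ih =>
    have hne : f (letter c) ≠ 1 := fun h => by
      have := hf.word_eq (letter c)
      rw [h, word_letter, List.append_assoc] at this
      exact List.append_ne_nil_of_right_ne_nil u (List.cons_ne_nil c v) this.symm
    rw [List.length_append, replace_mul_right F A _ _ hne, ih]

theorem colorAt_letter (hf : IsContext f u v) (c : Color) :
    colorAt (f (letter c)).word u.length = c := by
  simp [hf.word_eq, word_letter, colorAt]

theorem lt_length_letter (hf : IsContext f u v) (c : Color) :
    u.length < (f (letter c)).word.length := by
  simp [hf.word_eq, word_letter]

theorem double_letter (hf : IsContext f u v) (c : Color) :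
    (f (letter c)).double u.length = f (letter c * letter c) :=
  hf.replace_letter _ c

theorem toStrand_letter (hf : IsContext f u v) (c : Color) :
    (f (letter c)).toStrand u.length = f s :=
  hf.replace_letter _ c

end IsContext

end Context

section Graft

theorem eq_one_of_mul_eq_one {A B : Par} (h : A * B = 1) : A = 1 ∧ B = 1 := by
  induction A using WithOne.recOneCoe with
  | one => exact ⟨rfl, by simpa using h⟩
  | coe a =>
    induction B using WithOne.recOneCoe with
    | one => exact ⟨h, rfl⟩
    | coe b => exact absurd h (WithOne.coe_ne_one (a := a * b))

variable {f f' : Par → Par} {u u' v v' : List Color} {β : BraidInf}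

/-- In `β k`, the strands at the positions `i, …, i + k - 1` are parallel, straight and unmoved, and
doubling one of them gives `β (k + 1)`. -/
def IsParallelFamily (i : ℕ) (β : ℕ → BraidInf) : Prop :=
  ∀ k j, i ≤ j → j < i + k → cable j (β k) = β (k + 1) ∧ strandPerm (β k) j = j

theorem IsParallelFamily.shift_index {i : ℕ} {β : ℕ → BraidInf} (hβ : IsParallelFamily i β)
    {a b : ℕ} (hab : a ≤ b) : IsParallelFamily (i + a) fun k => β (k + b) := by
  intro k j hj hjk
  have := hβ (k + b) j (by omega) (by omega)
  rwa [Nat.add_right_comm] at this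

theorem ElementaryIso.graft {T : FreeMagma Color} {c : Color} {i : ℕ} {β : ℕ → BraidInf}
    (hβ : IsParallelFamily i β) (hf : IsContext f u v) (hf' : IsContext f' u' v')
    (hu : u.length = i) (hu' : u'.length = i) (hc : c = Color.pole ∨ Par.skeleton T = 1)
    (he : ElementaryIso (f (letter c)) (f' (letter c)) (β 1)) :
    ElementaryIso (f T) (f' T) (β (Par.word T).length) := by
  induction T using FreeMagma.rec generalizing c f f' u u' v v' i β with
  | of d =>
    by_cases hd : c = d
    · exact hd ▸ he
    have hfix := (hβ 1 i le_rfl (Nat.lt_succ_self i)).2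
    obtain ⟨rfl, rfl⟩ : c = Color.pole ∧ d = Color.strand := by
      cases c <;> cases d <;> simp_all [Par.skeleton, treeSkeleton, letter]
    have hstrand := he.toStrand (hf.colorAt_letter Color.pole)
    rwa [hu, hfix, ← hu, hf.toStrand_letter, hu, ← hu', hf'.toStrand_letter] at hstrand
  | mul A B ihA ihB =>
    obtain ⟨hcable, hfix⟩ := hβ 1 i le_rfl (Nat.lt_succ_self i)
    have hAB : c = Color.pole ∨ Par.skeleton A = 1 ∧ Par.skeleton B = 1 :=
      hc.imp_right eq_one_of_mul_eq_one
    have hdouble : ElementaryIso (f (letter c * letter c)) (f' (letter c * letter c)) (β 2) := by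
      have := he.double (hf.lt_length_letter c)
      rwa [hu, hcable, hfix, ← hu, hf.double_letter, hu, ← hu', hf'.double_letter] at this
    have hβB : IsParallelFamily (i + 1) fun k => β (k + 1) := hβ.shift_index le_rfl
    have hβA : IsParallelFamily i fun k => β (k + (Par.word B).length) :=
      hβ.shift_index (Nat.zero_le _)
    have hB := ihB hβB (hf.comp (.mul_left (letter c) .id)) (hf'.comp (.mul_left (letter c) .id))
      (by simp [hu, word_letter]) (by simp [hu', word_letter]) (hAB.imp_right And.right) hdouble
    rw [Nat.add_comm] at hB
    have hA := ihA hβA (hf.comp (.mul_right B .id)) (hf'.comp (.mul_right B .id))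
      (by simp [hu]) (by simp [hu']) (hAB.imp_right And.left) hB
    have hlength : (Par.word A).length + (Par.word B).length = (Par.word (A * B)).length :=
      List.length_append.symm
    rwa [hlength] at hA

theorem isParallelFamily_const_one (i : ℕ) : IsParallelFamily i fun _ => 1 :=
  fun _ j _ _ => ⟨cable_one j, by simp [strandPerm]⟩

theorem ElementaryIso.mul_left {O O' : Par} (he : ElementaryIso O O' β) (A : Par) :
    ElementaryIso (A * O) (A * O') (shift^[A.word.length] β) := by
  induction A using WithOne.recOneCoe with
  | one => rw [one_mul, one_mul]; exact he
  | coe A =>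
    have hβ : IsParallelFamily 0 fun k => shift^[k] β := fun k j _ hj =>
      ⟨cable_shift_iterate (by simpa using hj) β, strandPerm_shift_iterate (by simpa using hj) β⟩
    exact graft hβ (.mul_right O .id) (.mul_right O' .id) rfl rfl (.inl rfl) (he.left Color.pole)

theorem ElementaryIso.mul_right {O O' : Par} (he : ElementaryIso O O' β) (B : Par) :
    ElementaryIso (O * B) (O' * B) β := by
  induction B using WithOne.recOneCoe with
  | one => simpa only [mul_one] using he
  | coe B =>
    have hβ : IsParallelFamily O.word.length fun _ => β := fun _ j hj _ =>
      ⟨cable_of_le he.isMixedBraid.mem hj, strandPerm_of_le he.isMixedBraid.mem hj⟩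
    exact graft hβ (.mul_left O .id) (.mul_left O' .id) (by simp)
      (by simpa using he.isMixedBraid.length_eq) (.inl rfl) (he.right Color.pole)

theorem IsContext.elementaryIso {O O' : Par} (hf : IsContext f u v) (he : ElementaryIso O O' β) :
    ElementaryIso (f O) (f O') (shift^[u.length] β) := by
  induction hf with
  | id => exact he
  | mul_right B _ ih => exact ih.mul_right B
  | mul_left A _ ih =>
    rw [List.length_append, Function.iterate_add_apply]
    exact ih.mul_left A

theorem ElementaryIso.graft_assoc {a b c : Color} {A B C : FreeMagma Color}
    (he : ElementaryIso (letter a * letter b * letter c) (letter a * (letter b * letter c)) 1)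
    (hA : a = Color.pole ∨ Par.skeleton A = 1) (hB : b = Color.pole ∨ Par.skeleton B = 1)
    (hC : c = Color.pole ∨ Par.skeleton C = 1) :
    ElementaryIso (A * B * C : Par) (A * (B * C)) 1 := by
  have hC := he.graft (isParallelFamily_const_one 2) (.mul_left _ .id)
    (.mul_left _ (.mul_left _ .id)) rfl rfl hC
  have hB := hC.graft (isParallelFamily_const_one 1) (.mul_right _ (.mul_left _ .id))
    (.mul_left _ (.mul_right _ .id)) rfl rfl hB
  exact hB.graft (isParallelFamily_const_one 0) (.mul_right _ (.mul_right _ .id))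
    (.mul_right _ .id) rfl rfl hA

theorem exists_isContext {O : Par} {c : Color} (h : O.word = u ++ c :: v) :
    ∃ f, IsContext f u v ∧ f (letter c) = O := by
  induction O using WithOne.recOneCoe with
  | one => simp [Par.word] at h
  | coe t =>
    induction t using FreeMagma.rec generalizing u v with
    | of d =>
      obtain ⟨rfl, hd, rfl⟩ : u = [] ∧ d = c ∧ v = [] := by
        have h : u ++ c :: v = [d] := h.symm
        simpa [List.append_eq_singleton_iff, eq_comm] using h
      exact ⟨id, .id, congrArg letter hd.symm⟩
    | mul A B ihA ihB =>
      obtain ⟨z, rfl, hB⟩ | ⟨_ | ⟨d, z⟩, hA, hB⟩ := List.append_eq_append_iff.mp h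
      · obtain ⟨f, hf, hfB⟩ := ihB hB
        exact ⟨_, hf.mul_left A, congrArg ((A : Par) * ·) hfB⟩
      · obtain ⟨f, hf, hfB⟩ := ihB (u := []) hB.symm
        have hu : Par.word A ++ [] = u := (List.append_nil _).trans (hA.trans (List.append_nil u))
        exact ⟨_, hu ▸ hf.mul_left A, congrArg ((A : Par) * ·) hfB⟩
      · obtain ⟨rfl, rfl⟩ := List.cons_eq_cons.mp hB
        obtain ⟨f, hf, hfA⟩ := ihA hA
        exact ⟨_, hf.mul_right B, congrArg (· * (B : Par)) hfA⟩

theorem ElementaryIso.replace_letter {O O' : Par} (he : ElementaryIso O O' 1) {c : Color}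
    {T : FreeMagma Color} (hc : c = Color.pole ∨ Par.skeleton T = 1) (hO : O.word = u ++ c :: v)
    (hO' : O'.word = u ++ c :: v) :
    ElementaryIso (O.replace (fun _ => T) u.length) (O'.replace (fun _ => T) u.length) 1 := by
  obtain ⟨f, hf, rfl⟩ := exists_isContext hO
  obtain ⟨f', hf', rfl⟩ := exists_isContext hO'
  rw [hf.replace_letter, hf'.replace_letter]
  exact he.graft (isParallelFamily_const_one _) hf hf' rfl rfl hc

end Graft

section Rebracket

/-- `O` and `O'` are connected by a chain of elementary isomorphisms with trivial braid. -/
abbrev Rebracket : Par → Par → Prop := Relation.ReflTransGen fun O O' => ElementaryIso O O' 1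

variable {O O' : Par} {f g : Par → Par} {u v : List Color}

namespace Rebracket

theorem symm (h : Rebracket O O') : Rebracket O' O := by
  induction h with
  | refl => exact .refl
  | tail _ he ih => exact .head (by simpa only [inv_one] using he.symm) ih

theorem word_eq (h : Rebracket O O') : O.word = O'.word := by
  induction h with
  | refl => rfl
  | tail _ he ih =>
    refine ih.trans (eq_of_colorAt_eq he.isMixedBraid.length_eq.symm fun i => ?_)
    simpa [strandPerm] using (he.isMixedBraid.color i).symm

theorem skeleton_eq (h : Rebracket O O') : O.skeleton = O'.skeleton := by
  induction h with
  | refl => rfl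
  | tail _ he ih => exact ih.trans he.skeleton_eq

theorem context (h : Rebracket O O') (hf : IsContext f u v) : Rebracket (f O) (f O') :=
  h.lift f fun _ _ he => by simpa only [iterate_map_one] using hf.elementaryIso he

theorem mul_left (h : Rebracket O O') (A : Par) : Rebracket (A * O) (A * O') :=
  h.context (.mul_left A .id)

theorem mul_right (h : Rebracket O O') (B : Par) : Rebracket (O * B) (O' * B) :=
  h.context (.mul_right B .id)

theorem assoc (A B C : Par) (h : A.skeleton = 1 ∨ B.skeleton = 1 ∨ C.skeleton = 1) :
    Rebracket (A * B * C) (A * (B * C)) := by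
  induction A using WithOne.recOneCoe with
  | one => rw [one_mul, one_mul]
  | coe A =>
    induction B using WithOne.recOneCoe with
    | one => rw [mul_one, one_mul]
    | coe B =>
      induction C using WithOne.recOneCoe with
      | one => rw [mul_one, mul_one]
      | coe C =>
        refine .single ?_
        rcases h with h | h | h
        · exact (ElementaryIso.of_isBasic .alphaSPP).graft_assoc (.inr h) (.inl rfl) (.inl rfl)
        · exact (ElementaryIso.of_isBasic .alphaPSP).graft_assoc (.inl rfl) (.inr h) (.inl rfl)
        · exact (ElementaryIso.of_isBasic .alphaPPS).graft_assoc (.inl rfl) (.inl rfl) (.inr h)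

theorem graft {c : Color} {T : FreeMagma Color} (h : Rebracket (f (letter c)) (g (letter c)))
    (hf : IsContext f u v) (hg : IsContext g u v) (hc : c = Color.pole ∨ Par.skeleton T = 1) :
    Rebracket (f T) (g T) := by
  suffices ∀ O, Rebracket (f (letter c)) O →
      Rebracket (f T) (O.replace (fun _ => T) u.length) by
    simpa only [hg.replace_letter] using this _ h
  intro O hO
  induction hO with
  | refl => rw [hf.replace_letter]
  | tail hO he ih =>
    have hword : (f (letter c)).word = u ++ c :: v := by simp [hf.word_eq, word_letter]
    exact ih.tail (he.replace_letter hc (Rebracket.word_eq hO ▸ hword)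
      (Rebracket.word_eq (hO.tail he) ▸ hword))

end Rebracket

theorem word_one : Par.word 1 = [] := rfl

theorem eq_one_of_word_eq_nil (h : O.word = []) : O = 1 := by
  by_contra hne
  obtain ⟨t, rfl⟩ := WithOne.ne_one_iff_exists.mp hne
  induction t using FreeMagma.rec with
  | of c => exact List.cons_ne_nil _ _ h
  | mul A _ ihA _ => exact ihA (List.append_eq_nil_iff.mp h).1 WithOne.coe_ne_one

theorem eq_letter_of_word_eq {c : Color} (h : O.word = [c]) : O = letter c := by
  induction O using WithOne.recOneCoe with
  | one => exact absurd h (List.cons_ne_nil _ _).symm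
  | coe t =>
    cases t with
    | of d => exact congrArg letter (List.singleton_inj.mp h)
    | mul A B =>
      obtain ⟨hA, -⟩ | ⟨-, hB⟩ := List.append_eq_singleton_iff.mp h
      · exact absurd (eq_one_of_word_eq_nil (O := A) hA) WithOne.coe_ne_one
      · exact absurd (eq_one_of_word_eq_nil (O := B) hB) WithOne.coe_ne_one

theorem skeleton_eq_self (h : Color.strand ∉ O.word) : O.skeleton = O := by
  induction O using WithOne.recOneCoe with
  | one => rfl
  | coe t =>
    induction t using FreeMagma.rec with
    | of c =>
      cases c with
      | pole => rfl
      | strand => exact absurd (List.mem_singleton_self _) h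
    | mul A B ihA ihB =>
      exact congrArg₂ (· * ·) (ihA fun hA => h (List.mem_append_left _ hA))
        (ihB fun hB => h (List.mem_append_right _ hB))

namespace IsContext

theorem mul_strand (hf : IsContext f u []) (X : Par) : Rebracket (f X * s) (f (X * s)) := by
  generalize hv : ([] : List Color) = w at hf
  induction hf with
  | id => exact .refl
  | mul_right B _ ih =>
    obtain ⟨rfl, hB⟩ := List.append_eq_nil_iff.mp hv.symm
    obtain rfl := eq_one_of_word_eq_nil hB
    simpa only [mul_one] using ih rfl
  | mul_left A _ ih => exact (Rebracket.assoc _ _ _ (.inr (.inr rfl))).trans ((ih hv).mul_left A)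

theorem strand_mul (hf : IsContext f [] v) (X : Par) : Rebracket (s * f X) (f (s * X)) := by
  generalize hu : ([] : List Color) = w at hf
  induction hf with
  | id => exact .refl
  | mul_right B _ ih => exact (Rebracket.assoc _ _ _ (.inl rfl)).symm.trans ((ih hu).mul_right B)
  | mul_left A _ ih =>
    obtain ⟨hA, rfl⟩ := List.append_eq_nil_iff.mp hu.symm
    obtain rfl := eq_one_of_word_eq_nil hA
    simpa only [one_mul] using ih rfl

theorem exists_rebracket_mul_strand (hf : IsContext f u (Color.strand :: v)) :
    ∃ g, IsContext g u v ∧ ∀ X, Rebracket (f X) (g (X * s)) := by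
  generalize hw : Color.strand :: v = w at hf
  induction hf generalizing v with
  | id => exact absurd hw (List.cons_ne_nil _ _)
  | @mul_right f u w B hf ih =>
    obtain ⟨rfl, hB⟩ | ⟨w, rfl, rfl⟩ := List.append_eq_cons_iff.mp hw.symm
    · obtain ⟨h, hh, rfl⟩ := exists_isContext (u := []) hB
      refine ⟨fun X => f X * h 1, ?_, fun X => ?_⟩
      · have hv : [] ++ (h 1).word = v := by rw [hh.word_eq, word_one]; rfl
        exact hv ▸ hf.mul_right (h 1)
      have hsplit : Rebracket (h s) (s * h 1) := by
        simpa only [mul_one] using (hh.strand_mul 1).symm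
      exact ((hsplit.mul_left _).trans (Rebracket.assoc _ _ _ (.inr (.inl rfl))).symm).trans
        ((hf.mul_strand X).mul_right _)
    · obtain ⟨g, hg, hfg⟩ := ih rfl
      exact ⟨_, hg.mul_right B, fun X => (hfg X).mul_right B⟩
  | mul_left A _ ih =>
    obtain ⟨g, hg, hfg⟩ := ih hw
    exact ⟨_, hg.mul_left A, fun X => (hfg X).mul_left A⟩

theorem exists_rebracket_strand_mul (hf : IsContext f (u ++ [Color.strand]) v) :
    ∃ g, IsContext g u v ∧ ∀ X, Rebracket (f X) (g (s * X)) := by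
  generalize hw : u ++ [Color.strand] = w at hf
  induction hf generalizing u with
  | id => exact absurd hw (List.append_ne_nil_of_right_ne_nil _ (List.cons_ne_nil _ _))
  | mul_right B _ ih =>
    obtain ⟨g, hg, hfg⟩ := ih hw
    exact ⟨_, hg.mul_right B, fun X => (hfg X).mul_right B⟩
  | @mul_left f w v A hf ih =>
    obtain rfl | ⟨w, c, rfl⟩ := w.eq_nil_or_concat
    · obtain ⟨h, hh, rfl⟩ := exists_isContext (v := []) (hw.trans (List.append_nil _)).symm
      refine ⟨fun X => h 1 * f X, ?_, fun X => ?_⟩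
      · have hu : (h 1).word ++ [] = u := by simp only [hh.word_eq, word_one, List.append_nil]
        exact hu ▸ hf.mul_left (h 1)
      have hsplit : Rebracket (h s) (h 1 * s) := by
        simpa only [one_mul] using (hh.mul_strand 1).symm
      exact ((hsplit.mul_right _).trans (Rebracket.assoc _ _ _ (.inr (.inl rfl)))).trans
        ((hf.strand_mul X).mul_left _)
    · rw [List.concat_eq_append, ← List.append_assoc] at hw
      obtain ⟨rfl, hc⟩ := List.append_inj' hw rfl
      obtain ⟨g, hg, hfg⟩ := ih (List.concat_eq_append.trans (congrArg _ hc.symm)).symm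
      exact ⟨_, hg.mul_left A, fun X => (hfg X).mul_left A⟩

end IsContext

theorem exists_rebracket_pair {a b : Color} (h : O.word = u ++ a :: b :: v)
    (hab : ¬ (a = Color.pole ∧ b = Color.pole)) :
    ∃ g, IsContext g u v ∧ Rebracket O (g (letter a * letter b)) := by
  cases b with
  | strand =>
    obtain ⟨f, hf, rfl⟩ := exists_isContext h
    obtain ⟨g, hg, hfg⟩ := hf.exists_rebracket_mul_strand
    exact ⟨g, hg, hfg _⟩
  | pole =>
    obtain rfl : a = Color.strand := by cases a <;> simp_all
    obtain ⟨f, hf, rfl⟩ := exists_isContext (h.trans (List.append_cons u _ _))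
    obtain ⟨g, hg, hfg⟩ := hf.exists_rebracket_strand_mul
    exact ⟨g, hg, hfg _⟩

theorem exists_eq_append_pair_of_strand_mem {o : List Color} (h : Color.strand ∈ o) :
    o = [Color.strand] ∨
      ∃ u a b v, o = u ++ a :: b :: v ∧ ¬ (a = Color.pole ∧ b = Color.pole) := by
  obtain ⟨u, v, rfl⟩ := List.append_of_mem h
  rcases v with _ | ⟨b, v⟩
  · obtain rfl | ⟨u, a, rfl⟩ := u.eq_nil_or_concat
    · exact .inl rfl
    · exact .inr ⟨u, a, Color.strand, [], by simp, by simp⟩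
  · exact .inr ⟨u, Color.strand, b, v, rfl, by simp⟩

theorem exists_skeleton_letter_eq {a b : Color} (h : ¬ (a = Color.pole ∧ b = Color.pole)) :
    ∃ c, (letter c).skeleton = (letter a * letter b).skeleton ∧
      (c = Color.pole ∨ (letter a * letter b).skeleton = 1) := by
  cases a with
  | strand =>
    refine ⟨b, (one_mul _).symm, ?_⟩
    cases b with
    | pole => exact .inl rfl
    | strand => exact .inr rfl
  | pole =>
    cases b with
    | pole => exact absurd ⟨rfl, rfl⟩ h
    | strand => exact ⟨Color.pole, rfl, .inl rfl⟩

theorem rebracket_of_word_eq (hw : O.word = O'.word) (hs : O.skeleton = O'.skeleton) :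
    Rebracket O O' := by
  induction hn : O.word.length using Nat.strong_induction_on generalizing O O' with
  | _ n ih =>
  by_cases hstrand : Color.strand ∈ O.word
  · obtain h | ⟨u, a, b, v, h, hab⟩ := exists_eq_append_pair_of_strand_mem hstrand
    · rw [eq_letter_of_word_eq (O := O) h, eq_letter_of_word_eq (O := O') (hw ▸ h)]
    obtain ⟨c, hc, hpole⟩ := exists_skeleton_letter_eq hab
    obtain ⟨f, hf, hO⟩ := exists_rebracket_pair h hab
    obtain ⟨g, hg, hO'⟩ := exists_rebracket_pair (hw ▸ h) hab
    have hfg : Rebracket (f (letter c)) (g (letter c)) := by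
      refine ih _ ?_ ?_ ?_ rfl
      · simp [← hn, h, hf.word_eq, word_letter]
      · rw [hf.word_eq, hg.word_eq]
      · rw [hf.skeleton_congr hc, hg.skeleton_congr hc, ← hO.skeleton_eq, hs, hO'.skeleton_eq]
    exact (hO.trans (hfg.graft (T := FreeMagma.of a * FreeMagma.of b) hf hg hpole)).trans hO'.symm
  · rw [← skeleton_eq_self hstrand, hs, skeleton_eq_self (hw ▸ hstrand)]

end Rebracket

section BraidProduct

/-- The braids of compositions of elementary isomorphisms that are given by one braid each. -/
abbrev BraidProduct : Par → Par → BraidInf → Prop := LabelledPath ElementaryIso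

variable {O O' : Par} {β : BraidInf}

theorem Rebracket.braidProduct (h : Rebracket O O') : BraidProduct O O' 1 := by
  induction h with
  | refl => exact .one _
  | tail _ he ih => simpa only [mul_one] using ih.mul (.of he)

theorem iterate_shift_gen_zero (n : ℕ) : shift^[n] (gen 0) = gen n := by
  induction n with
  | zero => rfl
  | succ n ih => rw [Function.iterate_succ_apply', ih, shift_gen]

theorem elementaryIso_gen_zero {a b : Color} (hab : ¬ (a = Color.pole ∧ b = Color.pole)) :
    ElementaryIso (letter a * letter b) (letter b * letter a) (gen 0) := by
  have hpos : ElementaryIso (p * s) (s * p) (gen 0) := .of_isBasic .sigmaPos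
  have hneg : ElementaryIso (p * s) (s * p) (gen 0)⁻¹ := .of_isBasic .sigmaNeg
  cases a with
  | pole =>
    cases b with
    | pole => exact absurd ⟨rfl, rfl⟩ hab
    | strand => exact hpos
  | strand =>
    cases b with
    | pole => exact inv_inv (gen 0) ▸ hneg.symm
    | strand =>
      have := hpos.toStrand (i := 0) rfl
      rwa [strandPerm_gen, Equiv.swap_apply_left] at this

theorem exists_braidProduct_of_pair {u v : List Color} {a b : Color}
    (ho : O.word = u ++ a :: b :: v) (hab : ¬ (a = Color.pole ∧ b = Color.pole))
    (he : ElementaryIso (letter a * letter b) (letter b * letter a) β) :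
    ∃ O', O'.word = u ++ b :: a :: v ∧ BraidProduct O O' (shift^[u.length] β) := by
  obtain ⟨f, hf, hO⟩ := exists_rebracket_pair ho hab
  refine ⟨f (letter b * letter a), by simp [hf.word_eq, word_mul, word_letter], ?_⟩
  simpa only [one_mul] using hO.braidProduct.mul (.of (hf.elementaryIso he))

theorem LocalCrossing.exists_braidProduct {o' : List Color} (h : LocalCrossing O.word o' β) :
    ∃ O', O'.word = o' ∧ BraidProduct O O' β := by
  generalize ho : O.word = o at h
  cases h with
  | pos u v hab =>
    rw [← iterate_shift_gen_zero]
    exact exists_braidProduct_of_pair ho hab (elementaryIso_gen_zero hab)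
  | neg u v hab =>
    rw [← iterate_shift_gen_zero, ← iterate_map_inv]
    exact exists_braidProduct_of_pair ho hab (elementaryIso_gen_zero fun h => hab h.symm).symm

theorem LocalBraid.exists_braidProduct {o' : List Color} (h : LocalBraid O.word o' β) :
    ∃ O', O'.word = o' ∧ BraidProduct O O' β := by
  generalize ho : O.word = o at h
  induction h generalizing O with
  | one => exact ⟨O, ho, .one O⟩
  | of h => exact (ho ▸ h).exists_braidProduct
  | mul _ _ ih ih' =>
    obtain ⟨O₁, h₁, e₁⟩ := ih ho
    obtain ⟨O₂, h₂, e₂⟩ := ih' h₁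
    exact ⟨O₂, h₂, e₁.mul e₂⟩

theorem ofBraid_one (O : Par) : ofBraid 1 (.one O.word) rfl = 𝟙 O :=
  PaMBHom.ext (by ext; simp [ofBraid, strandPerm, CategoryStruct.id, MBHom.id]) rfl

theorem ofBraid_mul {O O' O'' : Par} {β γ : BraidInf} (h : IsMixedBraid O.word O'.word β)
    (hs : O.skeleton = O'.skeleton) (h' : IsMixedBraid O'.word O''.word γ)
    (hs' : O'.skeleton = O''.skeleton) :
    ofBraid (β * γ) (h.mul h') (hs.trans hs') = ofBraid β h hs ≫ ofBraid γ h' hs' := by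
  apply PaMBHom.ext
  · exact strandPerm_mul β γ
  · change _ = MonoidAlgebra.single β 1 * MonoidAlgebra.single γ 1
    simp [MonoidAlgebra.single_mul_single, ofBraid]

theorem isProduct_comp {O O' O'' : Par} {f : O ⟶ O'} {g : O' ⟶ O''} (hf : IsProduct f)
    (hg : IsProduct g) : IsProduct (f ≫ g) := by
  induction hf with
  | id => rwa [Category.id_comp]
  | comp f _ hf _ ih => rw [Category.assoc]; exact .comp _ _ hf (ih hg)

theorem BraidProduct.exists_isProduct (h : BraidProduct O O' β) :
    ∃ h hs, IsProduct (ofBraid (O := O) (O' := O') β h hs) := by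
  induction h with
  | one O => exact ⟨.one _, rfl, ofBraid_one O ▸ .id O⟩
  | of he =>
    obtain ⟨h, hs, he⟩ := he.hom
    exact ⟨h, hs, Category.comp_id (ofBraid _ h hs) ▸ .comp _ _ he (.id _)⟩
  | mul _ _ ih ih' =>
    obtain ⟨h, hs, hp⟩ := ih
    obtain ⟨h', hs', hp'⟩ := ih'
    exact ⟨h.mul h', hs.trans hs', ofBraid_mul h hs h' hs' ▸ isProduct_comp hp hp'⟩

theorem IsMixedBraid.isProduct_ofBraid (h : IsMixedBraid O.word O'.word β)
    (hs : O.skeleton = O'.skeleton) : IsProduct (ofBraid β h hs) := by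
  obtain ⟨O₁, hO₁, hβ⟩ := h.localBraid.exists_braidProduct
  obtain ⟨-, hs₁, -⟩ := hβ.exists_isProduct
  have hrebracket : Rebracket O₁ O' := rebracket_of_word_eq hO₁ (hs₁.symm.trans hs)
  have hβ : BraidProduct O O' β := by simpa only [mul_one] using hβ.mul hrebracket.braidProduct
  exact hβ.exists_isProduct.choose_spec.choose_spec

theorem isGenerated (f : O ⟶ O') : IsGenerated f := by
  rw [IsGenerated, ← MonoidAlgebra.sum_coeff_single f.comb]
  refine Submodule.sum_mem _ fun β hβ => ?_
  obtain ⟨h, hperm⟩ := f.isMixedBraid β hβ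
  rw [← mul_one (f.comb.coeff β), ← smul_eq_mul, ← MonoidAlgebra.smul_single]
  exact Submodule.smul_mem _ _
    (Submodule.subset_span ⟨_, h.isProduct_ofBraid f.skeleton_eq, hperm, rfl⟩)

end BraidProduct

end MixedBraids

theorem proposition4p1 :
    (∀ (O O' : MixedBraids.Par) (β : MixedBraids.BraidInf)
      (h : MixedBraids.IsMixedBraid O.word O'.word β) (hs : O.skeleton = O'.skeleton),
      MixedBraids.PaMB.IsProduct (MixedBraids.PaMB.ofBraid β h hs)) ∧
    ∀ (O O' : MixedBraids.Par) (f : O ⟶ O'), MixedBraids.PaMB.IsGenerated f :=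
  ⟨fun _ _ _ h hs => h.isProduct_ofBraid hs, fun _ _ f => MixedBraids.isGenerated f⟩
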